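/- Let $m>n\ge 3$ be integers, $\mu\ge 1$ real, $\delta\in(1/4,1)$ and $\varepsilon\in(0,1)$. For a positive integer $N$ let $\pi_N:\mathbb Z^m\to(\mathbb Z/N\mathbb Z)^m$ be the reduction map, and let $\Omega$ be the set of families $\mathfrak B=(v_1,\dots,v_n)$ of vectors in $\mathbb Z^m$ whose reductions modulo $N$ are linearly independent over $\mathbb Z/N\mathbb Z$ and which satisfy $\bigl(\frac1n\sum_i\|v_i\|^2\bigr)^{1/2}\le\mu$ (Euclidean norm). For $\mathfrak B\in\Omega$ let $\mathcal L(\mathfrak B)=\sum_i\mathbb Z v_i$ and $\mathcal H(\mathfrak B)=\{\sum_i a_i\pi_N(v_i) : a\in(\mathbb Z/N\mathbb Z)^n\}$. For a lattice $\Lambda\subseteq\mathbb Z^m$ write $\overline\Lambda=\Lambda_{\mathbb Q}\cap\mathbb Z^m$ for its completion and $\Lambda^\perp=\{v\in\mathbb Z^m:\langle v,w\rangle=0\ \forall w\in\Lambda\}$. An element $h\in\mathcal H(\mathfrak B)$ is regarded as the hidden lattice problem of computing, from $n$, $N$ and the subgroup $\mathcal M=\mathbb Z h\subseteq(\mathbb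 Z/N\mathbb Z)^m$, a basis of $\overline{\mathcal L(\mathfrak B)}$. Put $\mathcal M_N=\pi_N^{-1}(\mathcal M)$ and $\mathcal M^{\perp_N}=\{v\in\mathbb Z^m:\langle v,w\rangle\equiv 0\ (\mathrm{mod}\ N)\ \forall w\in\mathcal M_N\}$. Algorithm I with $\delta$-LLL computes a $\delta$-LLL reduced basis of $\mathcal M^{\perp_N}$, orders it by increasing norm as $u_1,\dots,u_m$, and returns a basis of $(\mathbb Z u_1+\dots+\mathbb Z u_{m-n})^\perp$. Algorithm II with $\delta$-LLL computes a $\delta$-LLL reduced basis of $\mathcal M_N$, orders it by increasing norm as $u_1,\dots,u_m$, and returns a basis of $\overline{\mathbb Z u_1+\dots+\mathbb Z u_n}$. A problem $h$ is solvable by one of these algorithms if the algorithm has an output on it and, whichever $\delta$-LLL reduced basis, ordering among vectors of equal norm and final basis are chosen, it returns a basis of $\overline{\mathcal L(\mathfrak B)}$. Then there exist positive real numbers $N^\dagger_{\mathrm I}$ and $N^\dagger_{\mathrm{II}}$, depending only on $n,m,\mu,\delta,\varepsilon$, such that for all integers $N>N^\dagger_{\mathrm I}$ (resp. $N>N^\dagger_{\mathrm{II}}$)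 and all $\mathfrak B\in\Omega$, at least $(1-\varepsilon)\,\#\mathcal H(\mathfrak B)$ of the problems in $\mathcal H(\mathfrak B)$ are solvable by Algorithm I (resp. Algorithm II) with $\delta$-LLL. In particular, for all integers $N>\min(N^\dagger_{\mathrm I},N^\dagger_{\mathrm{II}})$ and all $\mathfrak B\in\Omega$, at least $(1-\varepsilon)\,\#\mathcal H(\mathfrak B)$ of the problems in $\mathcal H(\mathfrak B)$ are solvable using $\delta$-LLL: by Algorithm I if $\min(N^\dagger_{\mathrm I},N^\dagger_{\mathrm{II}})=N^\dagger_{\mathrm I}$, and by Algorithm II otherwise. -/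

import Mathlib

noncomputable section

namespace HLP

/-- An integer vector, viewed in Euclidean space. -/
def toE {m : ℕ} (v : Fin m → ℤ) : EuclideanSpace ℝ (Fin m) :=
  WithLp.toLp 2 (fun j => (v j : ℝ))

/-- `b` is a `ℤ`-basis of the lattice `L ⊆ ℤ^m`. -/
def IsLatticeBasis {m k : ℕ} (b : Fin k → Fin m → ℤ) (L : Submodule ℤ (Fin m → ℤ)) : Prop :=
  LinearIndependent ℤ b ∧ Submodule.span ℤ (Set.range b) = L

/-- The size `σ(𝔅) = √((1/n) ∑ ‖v‖²)`. -/
def size {n m : ℕ} (B : Fin n → Fin m → ℤ) : ℝ :=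
  Real.sqrt ((1 / (n : ℝ)) * ∑ i, ‖toE (B i)‖ ^ 2)

/-- The inclusion `ℤ^m → ℚ^m`. -/
def toRat (m : ℕ) : (Fin m → ℤ) →ₗ[ℤ] (Fin m → ℚ) where
  toFun v := fun j => (v j : ℚ)
  map_add' v w := by ext j; simp
  map_smul' c v := by ext j; simp

/-- The completion `Λ_ℚ ∩ ℤ^m` of `Λ`. -/
def completion {m : ℕ} (L : Submodule ℤ (Fin m → ℤ)) : Submodule ℤ (Fin m → ℤ) :=
  ((Submodule.span ℚ (toRat m '' (L : Set (Fin m → ℤ)))).restrictScalars ℤ).comap (toRat m)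

/-- The orthogonal lattice `Λ^⊥ ⊆ ℤ^m`. -/
def orth {m : ℕ} (L : Submodule ℤ (Fin m → ℤ)) : Submodule ℤ (Fin m → ℤ) where
  carrier := {v | ∀ w ∈ L, v ⬝ᵥ w = 0}
  add_mem' {v v'} hv hv' w hw := by rw [add_dotProduct, hv w hw, hv' w hw, add_zero]
  zero_mem' w _ := zero_dotProduct w
  smul_mem' c v hv w hw := by rw [smul_dotProduct, hv w hw, smul_zero]

/-- Reduction modulo `N`, `π_N : ℤ^m → (ℤ/N)^m`. -/
def redMod (N m : ℕ) : (Fin m → ℤ) →ₗ[ℤ] (Fin m → ZMod N) where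
  toFun v := fun j => (v j : ZMod N)
  map_add' v w := by ext j; simp
  map_smul' c v := by ext j; simp

/-- The `N`-congruence lattice `M_N = π_N⁻¹(M)` of a subgroup `M ⊆ (ℤ/N)^m`. -/
def congLattice {N m : ℕ} (M : Submodule ℤ (Fin m → ZMod N)) : Submodule ℤ (Fin m → ℤ) :=
  M.comap (redMod N m)

/-- The `N`-orthogonal lattice `M^{⊥_N}`: the integer vectors `v` with `⟨v, w⟩ ≡ 0 (mod N)`
for all integer vectors `w` that lie in `M` modulo `N`. -/
def orthModLattice {N m : ℕ} (M : Submodule ℤ (Fin m → ZMod N)) :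
    Submodule ℤ (Fin m → ℤ) where
  carrier := {v | ∀ w ∈ congLattice M, (N : ℤ) ∣ v ⬝ᵥ w}
  add_mem' {v v'} hv hv' w hw := by
    rw [add_dotProduct]; exact dvd_add (hv w hw) (hv' w hw)
  zero_mem' w _ := by rw [zero_dotProduct]; exact dvd_zero _
  smul_mem' c v hv w hw := by
    rw [smul_dotProduct, smul_eq_mul]; exact Dvd.dvd.mul_left (hv w hw) c

/-- The Gram–Schmidt orthogonalization `b*₁, …, b*_k` of `b₁, …, b_k`. -/
def gs {m k : ℕ} (b : Fin k → Fin m → ℤ) : Fin k → EuclideanSpace ℝ (Fin m) :=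
  InnerProductSpace.gramSchmidt ℝ (fun i => toE (b i))

/-- The Gram–Schmidt coefficient `⟨b_i, b*_j⟩ / ⟨b*_j, b*_j⟩`. -/
def gsCoeff {m k : ℕ} (b : Fin k → Fin m → ℤ) (i j : Fin k) : ℝ :=
  inner ℝ (toE (b i)) (gs b j) / ‖gs b j‖ ^ 2

/-- `b` is a `δ`-LLL reduced basis of `L`: it is a basis of `L` which is size-reduced and
satisfies the Lovász condition at every pair of consecutive indices. -/
structure IsLLLReducedBasis {m k : ℕ} (δ : ℝ) (L : Submodule ℤ (Fin m → ℤ))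
    (b : Fin k → Fin m → ℤ) : Prop where
  basis : IsLatticeBasis b L
  size_reduced : ∀ i j : Fin k, j < i → |gsCoeff b i j| ≤ 1 / 2
  lovasz : ∀ i j : Fin k, (j : ℕ) + 1 = (i : ℕ) →
    δ * ‖gs b j‖ ^ 2 ≤ ‖gs b i + gsCoeff b i j • gs b j‖ ^ 2

/-- `u` lists the vectors of a `δ`-LLL reduced basis of `L`, ordered by increasing norm. -/
def IsOrderedLLLOutput {m k : ℕ} (δ : ℝ) (L : Submodule ℤ (Fin m → ℤ))
    (u : Fin k → Fin m → ℤ) : Prop :=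
  ∃ b : Fin k → Fin m → ℤ, IsLLLReducedBasis δ L b ∧
    ∃ s : Equiv.Perm (Fin k), u = b ∘ s ∧ Monotone (fun i => ‖toE (u i)‖)

/-- The lattice generated by the first `k` of the vectors `u₁, …, u_m`. -/
def firstSpan {m : ℕ} (k : ℕ) (u : Fin m → Fin m → ℤ) : Submodule ℤ (Fin m → ℤ) :=
  Submodule.span ℤ (u '' {i | (i : ℕ) < k})

/-- `w` is a possible output of Algorithm I with `δ`-LLL on input `n`, `N ≠ 0` and
`M ⊆ (ℤ/N)^m`: a `δ`-LLL reduced basis `u` of `M^{⊥_N}` is computed and ordered by increasing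
norm, and `w` is a basis of the orthogonal lattice of `⟨u₁, …, u_{m-n}⟩`. -/
def AlgorithmI {N m : ℕ} (δ : ℝ) (n : ℕ) (M : Submodule ℤ (Fin m → ZMod N))
    (w : Fin n → Fin m → ℤ) : Prop :=
  ∃ u : Fin m → Fin m → ℤ, IsOrderedLLLOutput δ (orthModLattice M) u ∧
    IsLatticeBasis w (orth (firstSpan (m - n) u))

/-- `w` is a possible output of Algorithm II with `δ`-LLL on input `n`, `N ≠ 0` and
`M ⊆ (ℤ/N)^m`: a `δ`-LLL reduced basis `u` of `M_N` is computed and ordered by increasing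
norm, and `w` is a basis of the completion of `⟨u₁, …, u_n⟩`. -/
def AlgorithmII {N m : ℕ} (δ : ℝ) (n : ℕ) (M : Submodule ℤ (Fin m → ZMod N))
    (w : Fin n → Fin m → ℤ) : Prop :=
  ∃ u : Fin m → Fin m → ℤ, IsOrderedLLLOutput δ (congLattice M) u ∧
    IsLatticeBasis w (completion (firstSpan n u))

/-- An algorithm, given by its set of possible outputs, computes a basis of `L`: it has an
output, and each of its possible outputs is a basis of `L`. -/
def Computes {m k : ℕ} (out : (Fin k → Fin m → ℤ) → Prop) (L : Submodule ℤ (Fin m → ℤ)) :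
    Prop :=
  (∃ w, out w) ∧ ∀ w, out w → IsLatticeBasis w L

/-- The set `Ω(n, m, μ)` (for the modulus `N`) of families of `n` vectors in `ℤ^m` that are
linearly independent over `ℤ/N` and of size at most `μ`. -/
def Omega (n m : ℕ) (μ : ℝ) (N : ℕ) : Set (Fin n → Fin m → ℤ) :=
  {B | LinearIndependent (ZMod N) (fun i => redMod N m (B i)) ∧ size B ≤ μ}

/-- The hidden lattice `ℒ(𝔅)` generated by `𝔅`. -/
def hidden {n m : ℕ} (B : Fin n → Fin m → ℤ) : Submodule ℤ (Fin m → ℤ) :=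
  Submodule.span ℤ (Set.range B)

/-- `F_𝔅 : (ℤ/N)^n → (ℤ/N)^m`, `a ↦ ∑ aᵢ π_N(vᵢ)`. -/
def F {n m : ℕ} (N : ℕ) (B : Fin n → Fin m → ℤ) (a : Fin n → ZMod N) : Fin m → ZMod N :=
  ∑ i, a i • redMod N m (B i)

/-- The sample space `ℋ(𝔅)`. -/
def H {n m : ℕ} (N : ℕ) (B : Fin n → Fin m → ℤ) : Set (Fin m → ZMod N) :=
  Set.range (F N B)

/-- The problems in `ℋ(𝔅)` for which Algorithm I with `δ`-LLL computes a basis of the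
completion of the hidden lattice. -/
def HI {n m : ℕ} (δ : ℝ) (N : ℕ) (B : Fin n → Fin m → ℤ) : Set (Fin m → ZMod N) :=
  {h | h ∈ H N B ∧
    Computes (AlgorithmI δ n (Submodule.span ℤ {h})) (completion (hidden B))}

/-- The problems in `ℋ(𝔅)` for which Algorithm II with `δ`-LLL computes a basis of the
completion of the hidden lattice. -/
def HII {n m : ℕ} (δ : ℝ) (N : ℕ) (B : Fin n → Fin m → ℤ) : Set (Fin m → ZMod N) :=
  {h | h ∈ H N B ∧
    Computes (AlgorithmII δ n (Submodule.span ℤ {h})) (completion (hidden B))}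

end HLP

end

noncomputable section

namespace HLP

open InnerProductSpace

/-! Write `h = F N B a`. Both algorithms succeed as soon as `a` satisfies no nonzero relation `∑ cᵢ
aᵢ = 0` modulo `N` with all `|cᵢ| ≤ R` (`NoShortRelation`), where `R` depends only on `n, m, μ, δ`.
A fixed nonzero relation with coefficients at most `R` holds for at most a fraction `R / N` of all
`a`, so by a union bound the bad `a` have proportion `O(1 / N)`
(`mul_ncard_not_noShortRelation_le`). Since `F N B` is injective, the same proportion holds in `H N
B`.

Choose `m - n` independent integer vectors `w` orthogonal to `B`, of norm at most a constant `K`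
that is uniform in `B` (`exists_bounded_orthogonal`).

Algorithm I: the `w j` lie in the `N`-orthogonal lattice, so by the LLL bounds the first `m - n`
output vectors `v` have bounded norm. The congruence `⟨v, h⟩ = 0` reads `∑ ⟨v, Bᵢ⟩ aᵢ = 0`, a short
relation, whence `⟨v, Bᵢ⟩ = 0`.

Algorithm II: a duality argument (`mul_norm_gs_last_le`) shows that the lattice of multiples of `a`
modulo `N` has a basis of norm `O(N / R)`, which `B` carries to `n` independent short vectors of the
congruence lattice. Hence the first `n` output vectors are short; their products with the `w j` are
multiples of `N` of absolute value less than `N`, so they vanish.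

In both cases orthogonality and complementary ranks determine the completion (`completion_eq_orth`).
Solvability also requires an output, so the existence of reduced bases is proved too
(`exists_isLLLReducedBasis`). -/

/-- `toE` as a `ℤ`-linear map. -/
def toEHom (m : ℕ) : (Fin m → ℤ) →ₗ[ℤ] EuclideanSpace ℝ (Fin m) where
  toFun := toE
  map_add' v w := by ext j; simp [toE]
  map_smul' c v := by ext j; simp [toE]

theorem toE_zero {m : ℕ} : toE (0 : Fin m → ℤ) = 0 :=
  (toEHom m).map_zero

theorem toE_add {m : ℕ} (v w : Fin m → ℤ) : toE (v + w) = toE v + toE w :=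
  (toEHom m).map_add v w

theorem toE_sub {m : ℕ} (v w : Fin m → ℤ) : toE (v - w) = toE v - toE w :=
  (toEHom m).map_sub v w

theorem toE_smul {m : ℕ} (c : ℤ) (v : Fin m → ℤ) : toE (c • v) = (c : ℝ) • toE v := by
  ext j; simp [toE]

theorem toE_sum {m : ℕ} {ι : Type*} (s : Finset ι) (v : ι → Fin m → ℤ) :
    toE (∑ i ∈ s, v i) = ∑ i ∈ s, toE (v i) :=
  map_sum (toEHom m) v s

theorem inner_toE {m : ℕ} (v w : Fin m → ℤ) :
    inner ℝ (toE v) (toE w) = ((v ⬝ᵥ w : ℤ) : ℝ) := by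
  simp [toE, PiLp.inner_apply, dotProduct, mul_comm]

theorem abs_le_norm_toE {m : ℕ} (v : Fin m → ℤ) (j : Fin m) : |(v j : ℝ)| ≤ ‖toE v‖ := by
  simpa [toE] using PiLp.norm_apply_le (toE v) j

/-- A square integer family that is independent over `ℤ` is independent over `ℝ`. -/
theorem linearIndependent_toE {m : ℕ} {b : Fin m → Fin m → ℤ} (hb : LinearIndependent ℤ b) :
    LinearIndependent ℝ (fun i => toE (b i)) := by
  have hdet : (Matrix.of b).det ≠ 0 := by
    intro h0
    obtain ⟨v, hv, hv0⟩ := Matrix.exists_vecMul_eq_zero_iff.2 h0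
    apply hv
    refine funext (Fintype.linearIndependent_iff.1 hb v ?_)
    rw [← hv0]
    ext j
    simp [Matrix.vecMul, dotProduct]
  rw [Fintype.linearIndependent_iff]
  intro g hg
  have hdet' : ((Matrix.of b).map (Int.castRingHom ℝ)).det ≠ 0 := by
    rw [← RingHom.mapMatrix_apply, ← RingHom.map_det]
    simpa using hdet
  by_contra! hne
  apply hdet'
  rw [← Matrix.exists_vecMul_eq_zero_iff]
  refine ⟨g, fun h => ?_, ?_⟩
  · obtain ⟨i, hi⟩ := hne
    exact hi (congrFun h i)
  · ext j
    have := congrArg (fun x : EuclideanSpace ℝ (Fin m) => x j) hg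
    simpa [Matrix.vecMul, dotProduct, toE] using this

/-! ### Gram–Schmidt vectors, Gram determinants and size reduction. -/

section GramSchmidt

variable {m k : ℕ} (b : Fin k → Fin m → ℤ)

theorem toE_eq_gs_add (i : Fin k) :
    toE (b i) = gs b i + ∑ j ∈ Finset.Iio i, gsCoeff b i j • gs b j := by
  have h := gramSchmidt_def'' ℝ (fun i => toE (b i)) i
  simp only [gs, gsCoeff]
  convert h using 4
  rw [real_inner_comm]
  simp

theorem inner_gs_of_ne {i j : Fin k} (h : i ≠ j) : inner ℝ (gs b i) (gs b j) = 0 :=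
  gramSchmidt_orthogonal ℝ _ h

theorem inner_toE_gs_self (i : Fin k) : inner ℝ (toE (b i)) (gs b i) = ‖gs b i‖ ^ 2 := by
  rw [toE_eq_gs_add, inner_add_left, sum_inner, Finset.sum_eq_zero, real_inner_self_eq_norm_sq,
    add_zero]
  intro j hj
  rw [inner_smul_left, inner_gs_of_ne b (Finset.mem_Iio.1 hj).ne, mul_zero]

theorem inner_toE_gs_of_lt {i j : Fin k} (h : i < j) : inner ℝ (toE (b i)) (gs b j) = 0 := by
  rw [real_inner_comm]
  exact gramSchmidt_inv_triangular ℝ (fun i => toE (b i)) h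

theorem gs_congr {b c : Fin k → Fin m → ℤ} {i : Fin k} (h : ∀ j ≤ i, b j = c j) :
    gs b i = gs c i := by
  induction i using WellFoundedLT.induction with
  | ind i ih =>
    have hb := toE_eq_gs_add b i
    have hc := toE_eq_gs_add c i
    have hs : ∑ j ∈ Finset.Iio i, gsCoeff b i j • gs b j =
        ∑ j ∈ Finset.Iio i, gsCoeff c i j • gs c j := by
      refine Finset.sum_congr rfl fun j hj => ?_
      have hj := Finset.mem_Iio.1 hj
      have := ih j hj fun l hl => h l (hl.trans hj.le)
      simp only [gsCoeff, this, h i le_rfl]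
    rw [h i le_rfl, hc, hs] at hb
    exact (add_right_cancel hb).symm

/-- The coefficients of `b` with respect to `gs b`: a unitriangular matrix. -/
def gsMatrix (i j : Fin k) : ℝ := if j < i then gsCoeff b i j else if j = i then 1 else 0

theorem toE_eq_sum_gsMatrix (i : Fin k) : toE (b i) = ∑ j, gsMatrix b i j • gs b j := by
  rw [← Finset.sum_subset (Finset.subset_univ (Finset.Iic i)), ← Finset.Iio_insert,
    Finset.sum_insert (by simp), toE_eq_gs_add]
  · congr 1
    · simp [gsMatrix]
    · refine Finset.sum_congr rfl fun j hj => ?_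
      rw [gsMatrix, if_pos (Finset.mem_Iio.1 hj)]
  · intro j _ hj
    rw [Finset.mem_Iic, not_le] at hj
    rw [gsMatrix, if_neg hj.not_gt, if_neg hj.ne', zero_smul]

/-- The factorization `T D Tᵀ` of the Gram matrix, entry by entry, with `T` unitriangular and `D`
diagonal. -/
theorem inner_toE_eq_sum (i j : Fin k) :
    inner ℝ (toE (b i)) (toE (b j)) = ∑ p, gsMatrix b i p * ‖gs b p‖ ^ 2 * gsMatrix b j p := by
  rw [toE_eq_sum_gsMatrix b i, toE_eq_sum_gsMatrix b j, sum_inner]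
  refine Finset.sum_congr rfl fun p _ => ?_
  rw [inner_sum, Finset.sum_eq_single p]
  · rw [inner_smul_left, inner_smul_right, real_inner_self_eq_norm_sq]
    simp; ring
  · intro q _ hq
    rw [inner_smul_left, inner_smul_right, inner_gs_of_ne b hq.symm]
    simp
  · simp

/-- The product of the squared Gram–Schmidt norms up to `r` is a Gram determinant, so it is a
natural number. -/
theorem exists_nat_eq_prod_norm_gs (r : Fin k) :
    ∃ d : ℕ, (d : ℝ) = ∏ i ∈ Finset.Iic r, ‖gs b i‖ ^ 2 := by
  let G : Matrix {i // i ≤ r} {i // i ≤ r} ℤ := Matrix.of fun i j => b i ⬝ᵥ b j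
  let T : Matrix {i // i ≤ r} {i // i ≤ r} ℝ := Matrix.of fun i j => gsMatrix b i j
  have hT : T.det = 1 := by
    rw [Matrix.det_of_isLowerTriangular]
    · simp [T, gsMatrix]
    · intro i j hij
      have hij : i < j := hij
      simp [T, gsMatrix, hij.not_gt, (show (i : Fin k) < j from hij).ne']
  have hG : G.map (Int.castRingHom ℝ) =
      T * Matrix.diagonal (fun i : {i // i ≤ r} => ‖gs b i‖ ^ 2) * T.transpose := by
    ext i j
    rw [Matrix.mul_apply]
    simp only [Matrix.map_apply, G, Matrix.of_apply, Matrix.mul_diagonal,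
      Matrix.transpose_apply, T]
    have := inner_toE_eq_sum b i j
    rw [inner_toE] at this
    rw [eq_intCast, this, ← Finset.sum_subset (Finset.subset_univ (Finset.Iic r)),
      ← Finset.sum_subtype (p := (· ≤ r)) (Finset.Iic r) (fun x => by simp)
        (fun p => gsMatrix b i p * ‖gs b p‖ ^ 2 * gsMatrix b j p)]
    intro p _ hp
    rw [Finset.mem_Iic, not_le] at hp
    have := i.2.trans_lt hp
    simp [gsMatrix, this.not_gt, this.ne']
  have hdet : (G.det : ℝ) = ∏ i ∈ Finset.Iic r, ‖gs b i‖ ^ 2 := by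
    have h1 : ((G.det : ℤ) : ℝ) = (G.map (Int.castRingHom ℝ)).det := by
      rw [← RingHom.mapMatrix_apply, ← RingHom.map_det, eq_intCast]
    have h2 : ∏ i ∈ Finset.Iic r, ‖gs b i‖ ^ 2 = ∏ i : {i // i ≤ r}, ‖gs b i‖ ^ 2 :=
      Finset.prod_subtype _ (fun x => by simp) _
    rw [h1, hG, Matrix.det_mul, Matrix.det_mul, Matrix.det_transpose, hT, Matrix.det_diagonal, h2]
    simp
  have h0 : 0 ≤ G.det := by
    have : (0 : ℝ) ≤ G.det := by rw [hdet]; positivity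
    exact_mod_cast this
  exact ⟨G.det.toNat, by rw [← hdet]; exact_mod_cast Int.toNat_of_nonneg h0⟩

/-- Orthogonal projection onto the span of the first Gram–Schmidt vectors. -/
theorem sum_gs_of_mem_span {i : Fin k} {x : EuclideanSpace ℝ (Fin m)}
    (hx : x ∈ Submodule.span ℝ (gs b '' Set.Iio i)) :
    ∑ j ∈ Finset.Iio i, (inner ℝ x (gs b j) / ‖gs b j‖ ^ 2) • gs b j = x := by
  induction hx using Submodule.span_induction with
  | mem x hx =>
    obtain ⟨p, hp, rfl⟩ := hx
    rw [Finset.sum_eq_single p]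
    · by_cases h0 : gs b p = 0
      · simp [h0]
      · rw [real_inner_self_eq_norm_sq, div_self (by simpa using h0), one_smul]
    · intro q _ hq
      rw [inner_gs_of_ne b hq.symm, zero_div, zero_smul]
    · intro h
      exact absurd (Finset.mem_Iio.2 hp) h
  | zero => simp
  | add x y _ _ hx hy =>
    conv_rhs => rw [← hx, ← hy]
    rw [← Finset.sum_add_distrib]
    simp only [inner_add_left, add_div, add_smul]
  | smul c x _ hx =>
    conv_rhs => rw [← hx]
    rw [Finset.smul_sum]
    simp only [real_inner_smul_left, smul_smul, mul_div_assoc]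

theorem toE_mem_span_gs {i : Fin k} {t : Fin m → ℤ}
    (ht : t ∈ Submodule.span ℤ (b '' Set.Iio i)) :
    toE t ∈ Submodule.span ℝ (gs b '' Set.Iio i) := by
  have hspan : Submodule.span ℝ (gs b '' Set.Iio i) =
      Submodule.span ℝ ((fun i => toE (b i)) '' Set.Iio i) :=
    span_gramSchmidt_Iio ℝ (fun i => toE (b i)) i
  rw [hspan]
  induction ht using Submodule.span_induction with
  | mem x hx =>
    obtain ⟨p, hp, rfl⟩ := hx
    exact Submodule.subset_span ⟨p, hp, rfl⟩
  | zero => rw [toE_zero]; exact Submodule.zero_mem _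
  | add x y _ _ hx hy => rw [toE_add]; exact Submodule.add_mem _ hx hy
  | smul c x _ hx => rw [toE_smul]; exact Submodule.smul_mem _ _ hx

theorem inner_toE_gs_of_mem_span {i : Fin k} {t : Fin m → ℤ}
    (ht : t ∈ Submodule.span ℤ (b '' Set.Iio i)) : inner ℝ (toE t) (gs b i) = 0 := by
  have h := toE_mem_span_gs b ht
  generalize toE t = y at h
  induction h using Submodule.span_induction with
  | mem x hx =>
    obtain ⟨p, hp, rfl⟩ := hx
    exact inner_gs_of_ne b (ne_of_lt hp)
  | zero => simp
  | add x y _ _ hx hy => rw [inner_add_left, hx, hy, add_zero]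
  | smul c x _ hx => rw [real_inner_smul_left, hx, mul_zero]

/-- Gram–Schmidt vectors are unchanged when combinations of earlier vectors are added. -/
theorem gs_eq_of_sub_mem {c : Fin k → Fin m → ℤ}
    (h : ∀ i, c i - b i ∈ Submodule.span ℤ (b '' Set.Iio i)) : gs c = gs b := by
  ext1 i
  induction i using WellFoundedLT.induction with
  | ind i ih =>
    have hb := toE_eq_gs_add b i
    have hc := toE_eq_gs_add c i
    have ht := sum_gs_of_mem_span b (toE_mem_span_gs b (h i))
    have hs : ∑ j ∈ Finset.Iio i, gsCoeff c i j • gs c j =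
        ∑ j ∈ Finset.Iio i, gsCoeff b i j • gs b j + toE (c i - b i) := by
      conv_rhs => rw [← ht]
      rw [← Finset.sum_add_distrib]
      refine Finset.sum_congr rfl fun j hj => ?_
      simp only [gsCoeff, ih j (Finset.mem_Iio.1 hj), ← add_smul, ← add_div, ← inner_add_left,
        toE_sub, add_sub_cancel]
    rw [hs, toE_sub, ← sub_eq_iff_eq_add] at hc
    rw [eq_sub_of_add_eq hb.symm, ← hc]
    abel

theorem span_eq_of_sub_mem {c : Fin k → Fin m → ℤ}
    (h : ∀ i, c i - b i ∈ Submodule.span ℤ (b '' Set.Iio i)) :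
    Submodule.span ℤ (Set.range c) = Submodule.span ℤ (Set.range b) := by
  apply le_antisymm
  · rw [Submodule.span_le]
    rintro _ ⟨i, rfl⟩
    have h1 := Submodule.span_mono (Set.image_subset_range b _) (h i)
    have := Submodule.add_mem _ h1 (Submodule.subset_span ⟨i, rfl⟩)
    simpa using this
  · rw [Submodule.span_le]
    rintro _ ⟨i, rfl⟩
    induction i using WellFoundedLT.induction with
    | ind i ih =>
      have hle : Submodule.span ℤ (b '' Set.Iio i) ≤ Submodule.span ℤ (Set.range c) := by
        rw [Submodule.span_le]
        rintro _ ⟨j, hj, rfl⟩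
        exact ih j hj
      have := Submodule.sub_mem _ (Submodule.subset_span (Set.mem_range_self i)) (hle (h i))
      simpa using this

/-- Nearest-plane rounding from the highest index down: later corrections use only lower vectors,
which are orthogonal to the Gram–Schmidt vectors already treated. -/
theorem exists_size_reduced_vector (x : Fin m → ℤ) (s : ℕ) (hs : s ≤ k) :
    ∃ y : Fin m → ℤ, y - x ∈ Submodule.span ℤ (b '' {j | (j : ℕ) < s}) ∧
      ∀ j : Fin k, (j : ℕ) < s → |inner ℝ (toE y) (gs b j) / ‖gs b j‖ ^ 2| ≤ 1 / 2 := by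
  induction s generalizing x with
  | zero => exact ⟨x, by simp, by simp⟩
  | succ s ih =>
    let p : Fin k := ⟨s, hs⟩
    let z : ℤ := round (inner ℝ (toE x) (gs b p) / ‖gs b p‖ ^ 2)
    obtain ⟨y, hy, hy'⟩ := ih (x - z • b p) (by omega)
    have hp : ({j | (j : ℕ) < s} : Set (Fin k)) = Set.Iio p := by
      ext j; simp [p, Fin.lt_def]
    refine ⟨y, ?_, fun j hj => ?_⟩
    · have h1 := Submodule.span_mono (Set.image_mono (f := b)
        (fun j hj => Nat.lt_succ_of_lt hj : {j : Fin k | (j : ℕ) < s} ⊆ {j | (j : ℕ) < s + 1})) hy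
      have h2 : b p ∈ Submodule.span ℤ (b '' {j | (j : ℕ) < s + 1}) :=
        Submodule.subset_span ⟨p, by simp [p], rfl⟩
      have h3 := Submodule.sub_mem _ h1 (Submodule.smul_mem _ z h2)
      have : y - (x - z • b p) - z • b p = y - x := by abel
      rwa [this] at h3
    · rcases Nat.lt_succ_iff_lt_or_eq.1 hj with hj | hj
      · exact hy' j hj
      · obtain rfl : j = p := Fin.ext hj
        rw [hp] at hy
        have h0 := inner_toE_gs_of_mem_span b hy
        rw [toE_sub, inner_sub_left, sub_eq_zero, toE_sub, toE_smul, inner_sub_left,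
          real_inner_smul_left, inner_toE_gs_self] at h0
        rw [h0]
        -- When the Gram–Schmidt vector vanishes, the coefficient is `0` by the convention for
        -- division by zero.
        by_cases hg : gs b p = 0
        · simp [hg]
        · have hg' : ‖gs b p‖ ^ 2 ≠ 0 := by simpa using hg
          rw [sub_div, mul_div_cancel_right₀ _ hg']
          exact abs_sub_round _

theorem exists_size_reduced {L : Submodule ℤ (Fin m → ℤ)} (hb : IsLatticeBasis b L) :
    ∃ c, IsLatticeBasis c L ∧ gs c = gs b ∧ ∀ i j : Fin k, j < i → |gsCoeff c i j| ≤ 1 / 2 := by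
  choose c hc hc' using fun i : Fin k => exists_size_reduced_vector b (b i) i i.2.le
  have hsub : ∀ i, c i - b i ∈ Submodule.span ℤ (b '' Set.Iio i) := hc
  have hgs := gs_eq_of_sub_mem b hsub
  have hspan := span_eq_of_sub_mem b hsub
  refine ⟨c, ⟨?_, hspan.trans hb.2⟩, hgs, fun i j hij => ?_⟩
  -- Independence is a matter of the rank of the span, and the span is unchanged.
  · rw [linearIndependent_iff_card_eq_finrank_span, Set.finrank, hspan, ← Set.finrank]
    exact linearIndependent_iff_card_eq_finrank_span.1 hb.1
  · rw [gsCoeff, hgs]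
    exact hc' i j hij

end GramSchmidt

/-! ### Existence of LLL reduced bases. -/

/-- Every full-rank sublattice of `ℤ^m` has a `δ`-LLL reduced basis: a size-reduced basis whose
Gram determinants are lexicographically minimal. -/
theorem exists_isLLLReducedBasis {m : ℕ} {δ : ℝ} (hδ : δ ≤ 1) {L : Submodule ℤ (Fin m → ℤ)}
    {b₀ : Fin m → Fin m → ℤ} (hb₀ : IsLatticeBasis b₀ L) :
    ∃ b : Fin m → Fin m → ℤ, IsLLLReducedBasis δ L b := by
  choose d hd using fun b : Fin m → Fin m → ℤ => exists_nat_eq_prod_norm_gs b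
  let D : (Fin m → Fin m → ℤ) → Lex (Fin m → ℕ) := fun b => toLex (d b)
  have hwf : WellFounded (fun b c => D b < D c) := InvImage.wf D wellFounded_lt
  obtain ⟨b₁, hb₁, hmin⟩ := hwf.has_min {b | IsLatticeBasis b L} ⟨b₀, hb₀⟩
  -- Size reduction fixes the Gram–Schmidt vectors, so it preserves minimality.
  obtain ⟨b, hb, hgs, hred⟩ := exists_size_reduced b₁ hb₁
  have hdb : d b = d b₁ := by
    ext r
    have : (d b r : ℝ) = d b₁ r := by rw [hd, hd, hgs]
    exact_mod_cast this
  refine ⟨b, hb, hred, fun i j hij => ?_⟩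
  by_contra! hlt
  have hij' : j < i := by rw [Fin.lt_def]; omega
  -- Swapping where the Lovász condition fails keeps the Gram determinants before `j` and strictly
  -- lowers the one at `j`, against minimality.
  let c := b ∘ Equiv.swap j i
  have hc : IsLatticeBasis c L := by
    refine ⟨hb.1.comp _ (Equiv.injective _), ?_⟩
    rw [Set.range_comp, Equiv.range_eq_univ, Set.image_univ]
    exact hb.2
  have hpre : ∀ l < j, gs c l = gs b l := fun l hl => gs_congr fun p hp => by
    have h1 : p < j := hp.trans_lt hl
    simp [c, Equiv.swap_apply_of_ne_of_ne h1.ne (h1.trans hij').ne]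
  have hcj : gs c j = gs b i + gsCoeff b i j • gs b j := by
    have h1 := toE_eq_gs_add c j
    have h2 := toE_eq_gs_add b i
    have hIio : Finset.Iio i = insert j (Finset.Iio j) := by
      ext p
      simp only [Finset.mem_Iio, Finset.mem_insert, Fin.lt_def, Fin.ext_iff]
      omega
    rw [hIio, Finset.sum_insert (by simp), ← add_assoc] at h2
    have h3 : c j = b i := by simp [c]
    have hs : ∑ p ∈ Finset.Iio j, gsCoeff c j p • gs c p =
        ∑ p ∈ Finset.Iio j, gsCoeff b i p • gs b p :=
      Finset.sum_congr rfl fun p hp => by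
        rw [gsCoeff, gsCoeff, hpre p (Finset.mem_Iio.1 hp), h3]
    rw [h3, hs, h2] at h1
    exact (add_right_cancel h1).symm
  apply hmin c hc
  change toLex (d c) < toLex (d b₁)
  rw [← hdb]
  refine ⟨j, fun l hl => ?_, ?_⟩
  · have : (d c l : ℝ) = d b l := by
      rw [hd, hd]
      exact Finset.prod_congr rfl fun p hp => by rw [hpre p ((Finset.mem_Iic.1 hp).trans_lt hl)]
    exact_mod_cast this
  · have : (d c j : ℝ) < d b j := by
      rw [hd, hd, ← Finset.Iio_insert, Finset.prod_insert (by simp), Finset.prod_insert (by simp),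
        Finset.prod_congr rfl fun p hp => by rw [hpre p (Finset.mem_Iio.1 hp)]]
      refine mul_lt_mul_of_pos_right ?_ ?_
      · rw [hcj]
        exact hlt.trans_le (mul_le_of_le_one_left (by positivity) hδ)
      · refine Finset.prod_pos fun p _ => ?_
        have : gs b p ≠ 0 := gramSchmidt_ne_zero p (linearIndependent_toE hb.1)
        positivity
    exact_mod_cast this

/-! ### Length bounds for LLL reduced bases. -/

section LLLBounds

variable {m k : ℕ} {δ : ℝ} {L : Submodule ℤ (Fin m → ℤ)} {b : Fin k → Fin m → ℤ}

theorem IsLLLReducedBasis.norm_sq_gs_le_of_succ (h : IsLLLReducedBasis δ L b) {i j : Fin k}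
    (hij : (j : ℕ) + 1 = i) : (δ - 1 / 4) * ‖gs b j‖ ^ 2 ≤ ‖gs b i‖ ^ 2 := by
  have hlt : j < i := by rw [Fin.lt_def]; omega
  have h1 := h.lovasz i j hij
  have h2 := h.size_reduced i j hlt
  have h3 : ‖gs b i + gsCoeff b i j • gs b j‖ ^ 2 =
      ‖gs b i‖ ^ 2 + gsCoeff b i j ^ 2 * ‖gs b j‖ ^ 2 := by
    rw [norm_add_sq_real, inner_smul_right, inner_gs_of_ne b hlt.ne', norm_smul, mul_pow,
      Real.norm_eq_abs, sq_abs]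
    ring
  have h4 : gsCoeff b i j ^ 2 ≤ 1 / 4 := by
    rw [← sq_abs]
    nlinarith [abs_nonneg (gsCoeff b i j)]
  nlinarith [sq_nonneg ‖gs b j‖]

theorem IsLLLReducedBasis.norm_sq_gs_le (h : IsLLLReducedBasis δ L b) (hδ : 1 / 4 < δ)
    (hδ' : δ < 1) {i j : Fin k} (hij : j ≤ i) :
    ‖gs b j‖ ^ 2 ≤ (1 / (δ - 1 / 4)) ^ k * ‖gs b i‖ ^ 2 := by
  have hpos : 0 < δ - 1 / 4 := by linarith
  have key : ∀ r : ℕ, ∀ i : Fin k, (j : ℕ) + r = i →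
      ‖gs b j‖ ^ 2 ≤ (1 / (δ - 1 / 4)) ^ r * ‖gs b i‖ ^ 2 := by
    intro r
    induction r with
    | zero =>
      intro i hi
      obtain rfl : j = i := Fin.ext hi
      simp
    | succ r ih =>
      intro i hi
      have h1 := ih ⟨j + r, by omega⟩ rfl
      have h2 := h.norm_sq_gs_le_of_succ (i := i) (j := ⟨j + r, by omega⟩) (by rw [← hi, add_assoc])
      refine h1.trans ?_
      rw [pow_succ (1 / (δ - 1 / 4)), mul_assoc]
      refine mul_le_mul_of_nonneg_left ?_ (by positivity)
      rw [one_div, ← div_eq_inv_mul, le_div_iff₀ hpos, mul_comm]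
      exact h2
  obtain ⟨r, hr⟩ := Nat.exists_eq_add_of_le (Fin.le_def.1 hij)
  refine (key r i hr.symm).trans (mul_le_mul_of_nonneg_right ?_ (by positivity))
  -- Since `δ < 1`, the ratio is at least `1`, so the exponent may be raised to the uniform value
  -- `k`.
  refine pow_le_pow_right₀ ?_ (by omega)
  rw [le_div_iff₀ hpos]
  linarith

/-- The approximation factor of a `δ`-LLL reduced basis of `k` vectors. -/
def lllFactor (k : ℕ) (δ : ℝ) : ℝ := k * √((1 / (δ - 1 / 4)) ^ k)

theorem lllFactor_nonneg (k : ℕ) (δ : ℝ) : 0 ≤ lllFactor k δ := by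
  unfold lllFactor; positivity

theorem IsLLLReducedBasis.norm_le (h : IsLLLReducedBasis δ L b) (hδ : 1 / 4 < δ)
    (hδ' : δ < 1) {i j : Fin k} (hij : j ≤ i) :
    ‖toE (b j)‖ ≤ lllFactor k δ * ‖gs b i‖ := by
  have hgs : ∀ l ≤ j, ‖gs b l‖ ≤ √((1 / (δ - 1 / 4)) ^ k) * ‖gs b i‖ := fun l hl => by
    have := Real.sqrt_le_sqrt (h.norm_sq_gs_le hδ hδ' (hl.trans hij))
    rwa [Real.sqrt_sq (norm_nonneg _), Real.sqrt_mul' _ (by positivity),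
      Real.sqrt_sq (norm_nonneg _)] at this
  set S := √((1 / (δ - 1 / 4)) ^ k) * ‖gs b i‖ with hS
  have hS0 : 0 ≤ S := by positivity
  rw [toE_eq_gs_add]
  calc ‖gs b j + ∑ l ∈ Finset.Iio j, gsCoeff b j l • gs b l‖
      ≤ ‖gs b j‖ + ∑ l ∈ Finset.Iio j, ‖gsCoeff b j l • gs b l‖ :=
        (norm_add_le _ _).trans (add_le_add_right (norm_sum_le _ _) _)
    _ ≤ S + ∑ l ∈ Finset.Iio j, S := by
        refine add_le_add (hgs j le_rfl) (Finset.sum_le_sum fun l hl => ?_)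
        have hl := Finset.mem_Iio.1 hl
        rw [norm_smul, Real.norm_eq_abs]
        have h1 := h.size_reduced j l hl
        have h2 := hgs l hl.le
        nlinarith [norm_nonneg (gs b l), abs_nonneg (gsCoeff b j l)]
    _ = ((j : ℕ) + 1 : ℝ) * S := by
        rw [Finset.sum_const, Fin.card_Iio, nsmul_eq_mul]; ring
    _ ≤ k * S := by
        refine mul_le_mul_of_nonneg_right ?_ hS0
        exact_mod_cast j.2
    _ = lllFactor k δ * ‖gs b i‖ := by rw [lllFactor, hS, mul_assoc]

/-- Take `j` to be the last index with nonzero coefficient `c j` in `x`. Then `⟨x, b*ⱼ⟩ = c j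
‖b*ⱼ‖²` with `|c j| ≥ 1`, and Cauchy–Schwarz concludes. -/
theorem exists_norm_gs_le_of_notMem (hb : IsLatticeBasis b L) {x : Fin m → ℤ} (hx : x ∈ L)
    {s : ℕ} (hxs : x ∉ Submodule.span ℤ (b '' {j | (j : ℕ) < s})) :
    ∃ j : Fin k, s ≤ j ∧ ‖gs b j‖ ≤ ‖toE x‖ := by
  rw [← hb.2, Submodule.mem_span_range_iff_exists_fun] at hx
  obtain ⟨c, rfl⟩ := hx
  obtain ⟨j₀, hj₀s, hj₀⟩ : ∃ j : Fin k, s ≤ j ∧ c j ≠ 0 := by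
    by_contra! hcon
    refine hxs (Submodule.sum_mem _ fun i _ => ?_)
    by_cases hi : (i : ℕ) < s
    · exact Submodule.smul_mem _ _ (Submodule.subset_span ⟨i, hi, rfl⟩)
    · rw [hcon i (not_lt.1 hi), zero_smul]
      exact Submodule.zero_mem _
  obtain ⟨j, hj, hmax⟩ := (Finset.univ.filter fun j => c j ≠ 0).exists_max_image id
    ⟨j₀, by simpa using hj₀⟩
  have hcj : c j ≠ 0 := by simpa using hj
  refine ⟨j, hj₀s.trans (hmax j₀ (by simpa using hj₀)), ?_⟩
  have hinner : inner ℝ (toE (∑ i, c i • b i)) (gs b j) = c j * ‖gs b j‖ ^ 2 := by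
    rw [toE_sum, sum_inner, Finset.sum_eq_single j]
    · rw [toE_smul, real_inner_smul_left, inner_toE_gs_self]
    · intro p _ hp
      rw [toE_smul, real_inner_smul_left]
      rcases lt_or_gt_of_ne hp with hp | hp
      · rw [inner_toE_gs_of_lt b hp, mul_zero]
      · have : c p = 0 := by
          by_contra hc
          exact absurd (hmax p (by simpa using hc)) (not_le.2 hp)
        rw [this]; simp
    · simp
  have h1 := abs_real_inner_le_norm (toE (∑ i, c i • b i)) (gs b j)
  rw [hinner, abs_mul, abs_of_nonneg (sq_nonneg ‖gs b j‖)] at h1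
  have h2 : (1 : ℝ) ≤ |(c j : ℝ)| := by exact_mod_cast Int.one_le_abs hcj
  by_contra! hlt
  have hpos : 0 < ‖gs b j‖ := (norm_nonneg _).trans_lt hlt
  nlinarith [mul_lt_mul_of_pos_right hlt hpos, mul_le_mul_of_nonneg_right h2 (sq_nonneg ‖gs b j‖)]

/-- The first `t` vectors of a reduced basis are at most `lllFactor k δ` times longer than any
`t` independent lattice vectors. -/
theorem IsLLLReducedBasis.norm_le_of_linearIndependent (h : IsLLLReducedBasis δ L b)
    (hδ : 1 / 4 < δ) (hδ' : δ < 1) {t : ℕ} {x : Fin t → Fin m → ℤ}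
    (hx : LinearIndependent ℤ x) (hxL : ∀ i, x i ∈ L) {X : ℝ} (hX : ∀ i, ‖toE (x i)‖ ≤ X)
    {l : Fin k} (hl : (l : ℕ) < t) : ‖toE (b l)‖ ≤ lllFactor k δ * X := by
  -- More than `l` independent vectors cannot all lie in the span of `l` vectors.
  obtain ⟨i, hi⟩ : ∃ i, x i ∉ Submodule.span ℤ (b '' {j | (j : ℕ) < l}) := by
    by_contra! hcon
    classical
    have h1 := linearIndependent_le_span_aux' x hx (b '' {j | (j : ℕ) < l})
      (by rintro _ ⟨i, rfl⟩; exact hcon i)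
    have h2 : ({j | (j : ℕ) < l} : Set (Fin k)) = ↑(Finset.Iio l) := by
      ext j; simp
    have h3 : (b '' {j | (j : ℕ) < l}).ncard ≤ l := by
      refine (Set.ncard_image_le (Set.toFinite _)).trans ?_
      rw [h2, Set.ncard_coe_finset, Fin.card_Iio]
    rw [Fintype.card_fin, ← Nat.card_eq_fintype_card, Nat.card_coe_set_eq] at h1
    omega
  obtain ⟨j, hj, hle⟩ := exists_norm_gs_le_of_notMem h.basis (hxL i) hi
  exact (h.norm_le hδ hδ' (Fin.le_def.2 hj)).trans
    (mul_le_mul_of_nonneg_left (hle.trans (hX i)) (lllFactor_nonneg k δ))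

theorem IsOrderedLLLOutput.norm_le_of_linearIndependent (h : IsOrderedLLLOutput δ L b)
    (hδ : 1 / 4 < δ) (hδ' : δ < 1) {t : ℕ} {x : Fin t → Fin m → ℤ}
    (hx : LinearIndependent ℤ x) (hxL : ∀ i, x i ∈ L) {X : ℝ} (hX : ∀ i, ‖toE (x i)‖ ≤ X)
    {l : Fin k} (hl : (l : ℕ) < t) : ‖toE (b l)‖ ≤ lllFactor k δ * X := by
  obtain ⟨c, hc, s, rfl, hmono⟩ := h
  -- Pigeonhole: the first `l + 1` vectors of `c` cannot all be sorted into the `l` positions before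
  -- `l`.
  obtain ⟨j, hjl, hj⟩ : ∃ j : Fin k, j ≤ l ∧ l ≤ s.symm j := by
    by_contra! hcon
    have hlt : ∀ j : Fin (l + 1), s.symm (Fin.castLE l.2 j) < l := fun j =>
      hcon _ (by rw [Fin.le_def]; exact Nat.lt_succ_iff.1 j.2)
    have := Fintype.card_le_of_injective
      (fun j : Fin (l + 1) => (⟨s.symm (Fin.castLE l.2 j), hlt j⟩ : Fin l)) (fun i j hij => by
        simpa [Fin.val_inj] using hij)
    simp at this
  have h1 := hmono hj
  simp only [Function.comp_apply, Equiv.apply_symm_apply] at h1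
  exact h1.trans (hc.norm_le_of_linearIndependent hδ hδ' hx hxL hX
    (lt_of_le_of_lt (Fin.le_def.1 hjl) hl))

theorem IsOrderedLLLOutput.isLatticeBasis (h : IsOrderedLLLOutput δ L b) :
    IsLatticeBasis b L := by
  obtain ⟨c, hc, s, rfl, -⟩ := h
  refine ⟨hc.basis.1.comp _ s.injective, ?_⟩
  rw [Set.range_comp, Equiv.range_eq_univ, Set.image_univ]
  exact hc.basis.2

end LLLBounds

theorem exists_isOrderedLLLOutput {m : ℕ} {δ : ℝ} (hδ : δ ≤ 1) {L : Submodule ℤ (Fin m → ℤ)}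
    {b₀ : Fin m → Fin m → ℤ} (hb₀ : IsLatticeBasis b₀ L) :
    ∃ u : Fin m → Fin m → ℤ, IsOrderedLLLOutput δ L u := by
  obtain ⟨b, hb⟩ := exists_isLLLReducedBasis hδ hb₀
  exact ⟨_, b, hb, Tuple.sort fun i => ‖toE (b i)‖, rfl,
    Tuple.monotone_sort fun i => ‖toE (b i)‖⟩

/-! ### Ranks, completions and orthogonal lattices. -/

section Rank

variable {m : ℕ}

theorem exists_isLatticeBasis_of_finrank_eq (L : Submodule ℤ (Fin m → ℤ)) {k : ℕ}
    (hk : Module.finrank ℤ L = k) : ∃ b : Fin k → Fin m → ℤ, IsLatticeBasis b L := by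
  let B := Module.finBasisOfFinrankEq ℤ L hk
  refine ⟨fun i => B i, B.linearIndependent.map' L.subtype (by simp), ?_⟩
  have := congrArg (Submodule.map L.subtype) B.span_eq
  rw [Submodule.map_span, ← Set.range_comp, Submodule.map_top, Submodule.range_subtype] at this
  exact this

theorem exists_isLatticeBasis_of_smul_mem {L : Submodule ℤ (Fin m → ℤ)} {N : ℤ} (hN : N ≠ 0)
    (h : ∀ v, N • v ∈ L) : ∃ b : Fin m → Fin m → ℤ, IsLatticeBasis b L := by
  refine exists_isLatticeBasis_of_finrank_eq L (le_antisymm ?_ ?_)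
  · simpa using Submodule.finrank_le L
  · let f : (Fin m → ℤ) →ₗ[ℤ] L := LinearMap.codRestrict L (N • LinearMap.id) h
    have hf : Function.Injective f := fun v w hvw => by
      have := congrArg Subtype.val hvw
      exact smul_right_injective _ hN this
    simpa using LinearMap.finrank_le_finrank_of_injective hf

theorem dotProduct_eq_zero_of_mem_span {x y : Set (Fin m → ℤ)}
    (h : ∀ v ∈ x, ∀ w ∈ y, v ⬝ᵥ w = 0) {v w : Fin m → ℤ} (hv : v ∈ Submodule.span ℤ x)
    (hw : w ∈ Submodule.span ℤ y) : v ⬝ᵥ w = 0 := by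
  induction hv, hw using Submodule.span_induction₂ with
  | mem_mem v w hv hw => exact h v hv w hw
  | zero_left => simp
  | zero_right => simp
  | add_left _ _ _ _ _ _ h1 h2 => rw [add_dotProduct, h1, h2, add_zero]
  | add_right _ _ _ _ _ _ h1 h2 => rw [dotProduct_add, h1, h2, add_zero]
  | smul_left _ _ _ _ _ h1 => rw [smul_dotProduct, h1, smul_zero]
  | smul_right _ _ _ _ _ h1 => rw [dotProduct_smul, h1, smul_zero]

/-- The two spans meet only in `0`, because the dot product is anisotropic over `ℤ`. -/
theorem add_le_of_orthogonal {p q : ℕ} {x : Fin p → Fin m → ℤ} {y : Fin q → Fin m → ℤ}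
    (hx : LinearIndependent ℤ x) (hy : LinearIndependent ℤ y) (hxy : ∀ i j, x i ⬝ᵥ y j = 0) :
    p + q ≤ m := by
  have hdisj : Disjoint (Submodule.span ℤ (Set.range x)) (Submodule.span ℤ (Set.range y)) := by
    rw [Submodule.disjoint_def]
    intro v hvx hvy
    refine dotProduct_self_eq_zero.1 (dotProduct_eq_zero_of_mem_span ?_ hvx hvy)
    rintro _ ⟨i, rfl⟩ _ ⟨j, rfl⟩
    exact hxy i j
  simpa using (hx.sum_type hy hdisj).fintype_card_le_finrank

/-- Clearing denominators turns the rational span into a torsion condition over `ℤ`. -/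
theorem mem_completion_iff {L : Submodule ℤ (Fin m → ℤ)} {v : Fin m → ℤ} :
    v ∈ completion L ↔ ∃ c : ℤ, c ≠ 0 ∧ c • v ∈ L := by
  have hinj : Function.Injective (toRat m) := fun v w h => by
    ext j
    exact Int.cast_injective (α := ℚ) (congrFun h j)
  constructor
  · intro hv
    have hv : toRat m v ∈ Submodule.span ℚ (toRat m '' (L : Set (Fin m → ℤ))) := hv
    have key : ∀ y ∈ Submodule.span ℚ (toRat m '' (L : Set (Fin m → ℤ))),
        ∃ c : ℤ, c ≠ 0 ∧ ∃ w ∈ L, c • y = toRat m w := by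
      intro y hy
      induction hy using Submodule.span_induction with
      | mem y hy =>
        obtain ⟨w, hw, rfl⟩ := hy
        exact ⟨1, one_ne_zero, w, hw, one_smul _ _⟩
      | zero => exact ⟨1, one_ne_zero, 0, zero_mem _, by simp⟩
      | add y z _ _ hy hz =>
        obtain ⟨c, hc, w, hw, h1⟩ := hy
        obtain ⟨d, hd, t, ht, h2⟩ := hz
        refine ⟨c * d, mul_ne_zero hc hd, d • w + c • t,
          add_mem (L.smul_mem _ hw) (L.smul_mem _ ht), ?_⟩
        rw [map_add, map_smul, map_smul, ← h1, ← h2, smul_add, smul_smul, smul_smul, mul_comm d c]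
      | smul q y _ hy =>
        obtain ⟨c, hc, w, hw, h1⟩ := hy
        refine ⟨q.den * c, mul_ne_zero (by exact_mod_cast q.den_ne_zero) hc, q.num • w,
          L.smul_mem _ hw, ?_⟩
        rw [map_smul, ← h1]
        ext j
        simp only [Pi.smul_apply, zsmul_eq_mul, smul_eq_mul, Pi.mul_apply, Pi.intCast_apply, Int.cast_mul, Int.cast_natCast]
        have := Rat.mul_den_eq_num q
        linear_combination (c * y j : ℚ) * this
    obtain ⟨c, hc, w, hw, h⟩ := key _ hv
    rw [← map_smul] at h
    exact ⟨c, hc, hinj h ▸ hw⟩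
  · rintro ⟨c, hc, hcv⟩
    change toRat m v ∈ Submodule.span ℚ (toRat m '' (L : Set (Fin m → ℤ)))
    have h1 : toRat m (c • v) ∈ Submodule.span ℚ (toRat m '' (L : Set (Fin m → ℤ))) :=
      Submodule.subset_span ⟨_, hcv, rfl⟩
    have h2 := Submodule.smul_mem _ ((c : ℚ)⁻¹) h1
    convert h2 using 1
    ext j
    have : (c : ℚ) ≠ 0 := by exact_mod_cast hc
    simp [toRat, this]

theorem mem_orth_span_range {q : ℕ} {y : Fin q → Fin m → ℤ} {v : Fin m → ℤ} :
    v ∈ orth (Submodule.span ℤ (Set.range y)) ↔ ∀ j, v ⬝ᵥ y j = 0 := by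
  refine ⟨fun h j => h _ (Submodule.subset_span ⟨j, rfl⟩), fun h w hw => ?_⟩
  refine dotProduct_eq_zero_of_mem_span (x := {v}) (y := Set.range y) ?_
    (Submodule.mem_span_singleton_self v) hw
  rintro _ rfl _ ⟨j, rfl⟩
  exact h j

/-- A vector orthogonal to `y` but with no nonzero multiple in the span of `x` could be adjoined to
`x`, giving `p + 1 + q ≤ m`. -/
theorem completion_eq_orth {p q : ℕ} {x : Fin p → Fin m → ℤ} {y : Fin q → Fin m → ℤ}
    (hx : LinearIndependent ℤ x) (hy : LinearIndependent ℤ y) (hxy : ∀ i j, x i ⬝ᵥ y j = 0)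
    (hpq : p + q = m) :
    completion (Submodule.span ℤ (Set.range x)) = orth (Submodule.span ℤ (Set.range y)) := by
  ext v
  rw [mem_completion_iff, mem_orth_span_range]
  constructor
  · rintro ⟨c, hc, hcv⟩ j
    have h1 : (c • v) ⬝ᵥ y j = 0 := by
      refine dotProduct_eq_zero_of_mem_span (x := Set.range x) (y := Set.range y) ?_ hcv
        (Submodule.subset_span ⟨j, rfl⟩)
      rintro _ ⟨i, rfl⟩ _ ⟨j, rfl⟩
      exact hxy i j
    rw [smul_dotProduct, smul_eq_mul] at h1
    exact (mul_eq_zero.1 h1).resolve_left hc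
  · intro hv
    by_contra! hcon
    have hli : LinearIndependent ℤ (Fin.snoc x v : Fin (p + 1) → Fin m → ℤ) := by
      refine LinearIndependent.finSnoc' x v hx fun c w hw hcw => ?_
      by_contra hc
      refine hcon c hc ?_
      rw [eq_neg_of_add_eq_zero_left hcw]
      exact neg_mem hw
    have := add_le_of_orthogonal hli hy fun i j => by
      refine Fin.lastCases ?_ (fun i => ?_) i
      · simpa using hv j
      · simpa using hxy i j
    omega

theorem exists_isLatticeBasis_completion {p q : ℕ} {x : Fin p → Fin m → ℤ}
    {y : Fin q → Fin m → ℤ} (hx : LinearIndependent ℤ x) (hy : LinearIndependent ℤ y)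
    (hxy : ∀ i j, x i ⬝ᵥ y j = 0) (hpq : p + q = m) :
    ∃ w : Fin p → Fin m → ℤ,
      IsLatticeBasis w (completion (Submodule.span ℤ (Set.range x))) := by
  have heq := completion_eq_orth hx hy hxy hpq
  apply exists_isLatticeBasis_of_finrank_eq
  apply le_antisymm
  · obtain ⟨w, hw⟩ := exists_isLatticeBasis_of_finrank_eq _
      (rfl : Module.finrank ℤ (completion (Submodule.span ℤ (Set.range x))) = _)
    have := add_le_of_orthogonal hw.1 hy fun i j => by
      have : w i ∈ orth (Submodule.span ℤ (Set.range y)) := by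
        rw [← heq, ← hw.2]
        exact Submodule.subset_span ⟨i, rfl⟩
      exact mem_orth_span_range.1 this j
    omega
  · have h1 : Submodule.span ℤ (Set.range x) ≤ completion (Submodule.span ℤ (Set.range x)) :=
      fun v hv => mem_completion_iff.2 ⟨1, one_ne_zero, by rwa [one_smul]⟩
    have h2 := Submodule.finrank_mono h1
    rwa [finrank_span_eq_card hx, Fintype.card_fin] at h2

/-- The lattice orthogonal to `n` vectors of `ℤ^m` contains `m - n` independent vectors. -/
theorem exists_linearIndependent_orthogonal {n : ℕ} (x : Fin n → Fin m → ℤ) :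
    ∃ w : Fin (m - n) → Fin m → ℤ, LinearIndependent ℤ w ∧ ∀ i j, x i ⬝ᵥ w j = 0 := by
  let f : (Fin m → ℤ) →ₗ[ℤ] (Fin n → ℤ) := (Matrix.of x).mulVecLin
  have h1 := Submodule.finrank_quotient_add_finrank (LinearMap.ker f)
  rw [f.quotKerEquivRange.finrank_eq, Module.finrank_fin_fun] at h1
  have h2 : Module.finrank ℤ (LinearMap.range f) ≤ n := by
    simpa using Submodule.finrank_le (LinearMap.range f)
  obtain ⟨w, hw, hspan⟩ := exists_isLatticeBasis_of_finrank_eq (LinearMap.ker f) rfl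
  have hle : m - n ≤ Module.finrank ℤ (LinearMap.ker f) := by omega
  refine ⟨w ∘ Fin.castLE hle, hw.comp _ (Fin.castLE_injective hle), fun i j => ?_⟩
  have : w (Fin.castLE hle j) ∈ LinearMap.ker f :=
    hspan.le (Submodule.subset_span ⟨_, rfl⟩)
  exact congrFun (LinearMap.mem_ker.1 this) i

theorem firstSpan_eq {k : ℕ} (hk : k ≤ m) (u : Fin m → Fin m → ℤ) :
    firstSpan k u = Submodule.span ℤ (Set.range (u ∘ Fin.castLE hk)) := by
  rw [firstSpan, Set.range_comp]
  congr 2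
  ext i
  simp [Fin.range_castLE]

end Rank

/-! ### Counting coefficient vectors with a short relation. -/

section Counting

/-- `a` satisfies no nontrivial linear relation modulo `N` with coefficients at most `R`. -/
def NoShortRelation {n N : ℕ} (R : ℕ) (a : Fin n → ZMod N) : Prop :=
  ∀ c : Fin n → ℤ, (∀ i, |c i| ≤ R) → ∑ i, (c i : ZMod N) * a i = 0 → c = 0

variable {n N : ℕ} [NeZero N]

/-- The solutions form the kernel of a homomorphism to `ZMod N` whose image contains the multiples
of some `c i ≠ 0`. If `o` is the additive order of `c i`, then `N` divides the nonzero integer `o *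
c i`, so `o ≥ N / R`; primality of `N` plays no role. -/
theorem mul_card_relation_le {c : Fin n → ℤ} (hc : c ≠ 0) {R : ℕ} (hcR : ∀ i, |c i| ≤ R) :
    N * Nat.card {a : Fin n → ZMod N // ∑ i, (c i : ZMod N) * a i = 0} ≤ R * N ^ n := by
  let φ : (Fin n → ZMod N) →+ ZMod N :=
    { toFun := fun a => ∑ i, (c i : ZMod N) * a i
      map_zero' := by simp
      map_add' := fun a b => by simp [mul_add, Finset.sum_add_distrib] }
  obtain ⟨i, hi⟩ := Function.ne_iff.1 hc
  have hi : c i ≠ 0 := hi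
  have hrange : AddSubgroup.zmultiples (c i : ZMod N) ≤ φ.range := by
    rw [AddSubgroup.zmultiples_le]
    exact ⟨Pi.single i 1, by simp [φ, Pi.single_apply]⟩
  have hcard : addOrderOf (c i : ZMod N) ≤ Nat.card φ.range := by
    rw [← Nat.card_zmultiples]
    exact AddSubgroup.card_le_of_le hrange
  have hord : N ≤ addOrderOf (c i : ZMod N) * R := by
    have h0 := addOrderOf_nsmul_eq_zero (c i : ZMod N)
    have hpos : 0 < addOrderOf (c i : ZMod N) := addOrderOf_pos _
    set o := addOrderOf (c i : ZMod N)
    have h1 : (N : ℤ) ∣ o * c i := by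
      rw [← ZMod.intCast_zmod_eq_zero_iff_dvd]
      push_cast
      rwa [nsmul_eq_mul] at h0
    have h2 : (N : ℤ) ≤ |o * c i| :=
      Int.le_of_dvd (abs_pos.2 (mul_ne_zero (by exact_mod_cast hpos.ne') hi))
        ((dvd_abs _ _).2 h1)
    rw [abs_mul, Nat.abs_cast] at h2
    have h3 : (N : ℤ) ≤ o * R := h2.trans (mul_le_mul_of_nonneg_left (hcR i) (by positivity))
    exact_mod_cast h3
  have hker : Nat.card φ.ker * Nat.card φ.range = N ^ n := by
    rw [← AddSubgroup.index_ker, AddSubgroup.card_mul_index]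
    simp [Nat.card_eq_fintype_card, ZMod.card]
  have heq : Nat.card {a : Fin n → ZMod N // ∑ i, (c i : ZMod N) * a i = 0} = Nat.card φ.ker :=
    rfl
  rw [heq, ← hker]
  calc N * Nat.card φ.ker ≤ (Nat.card φ.range * R) * Nat.card φ.ker :=
        Nat.mul_le_mul_right _ (hord.trans (Nat.mul_le_mul_right _ hcard))
    _ = R * (Nat.card φ.ker * Nat.card φ.range) := by ring

/-- Union bound over the `(2R + 1) ^ n` coefficient vectors in the box. -/
theorem mul_ncard_not_noShortRelation_le (R : ℕ) :
    N * {a : Fin n → ZMod N | ¬ NoShortRelation R a}.ncard ≤ (2 * R + 1) ^ n * (R * N ^ n) := by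
  classical
  let box : Finset (Fin n → ℤ) := Fintype.piFinset fun _ => Finset.Icc (-(R : ℤ)) R
  let rel : (Fin n → ℤ) → Finset (Fin n → ZMod N) := fun c =>
    Finset.univ.filter fun a => ∑ i, (c i : ZMod N) * a i = 0
  have hsub : {a : Fin n → ZMod N | ¬ NoShortRelation R a} ⊆ ((box.erase 0).biUnion rel : Set _) := by
    intro a ha
    simp only [NoShortRelation, Set.mem_ofPred_eq, not_forall] at ha
    obtain ⟨c, hc, hca, hc0⟩ := ha
    rw [Finset.mem_coe, Finset.mem_biUnion]
    refine ⟨c, Finset.mem_erase.2 ⟨hc0, Fintype.mem_piFinset.2 fun i => ?_⟩, by simpa [rel] using hca⟩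
    rw [Finset.mem_Icc]
    exact abs_le.1 (hc i)
  have hbox : box.card = (2 * R + 1) ^ n := by
    simp only [box, Fintype.card_piFinset, Int.card_Icc, Finset.prod_const, Finset.card_univ,
      Fintype.card_fin]
    congr 1
    omega
  have h1 := Set.ncard_le_ncard hsub (Finset.finite_toSet _)
  rw [Set.ncard_coe_finset] at h1
  calc N * {a : Fin n → ZMod N | ¬ NoShortRelation R a}.ncard
      ≤ N * ∑ c ∈ box.erase 0, (rel c).card :=
        Nat.mul_le_mul_left _ (h1.trans Finset.card_biUnion_le)
    _ = ∑ c ∈ box.erase 0, N * (rel c).card := Finset.mul_sum _ _ _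
    _ ≤ ∑ c ∈ box.erase 0, R * N ^ n := by
        refine Finset.sum_le_sum fun c hc => ?_
        obtain ⟨hc0, hc⟩ := Finset.mem_erase.1 hc
        have h2 := mul_card_relation_le (N := N) hc0 (R := R) fun i =>
          abs_le.2 (Finset.mem_Icc.1 (Fintype.mem_piFinset.1 hc i))
        rwa [Nat.card_eq_fintype_card, Fintype.card_subtype] at h2
    _ = (box.erase 0).card * (R * N ^ n) := by rw [Finset.sum_const, smul_eq_mul]
    _ ≤ (2 * R + 1) ^ n * (R * N ^ n) :=
        Nat.mul_le_mul_right _ (hbox ▸ Finset.card_erase_le)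

theorem le_ncard_noShortRelation {R : ℕ} {ε : ℝ} (hε : 0 < ε)
    (hN : ((2 * R + 1) ^ n * R : ℝ) / ε ≤ N) :
    (1 - ε) * (N : ℝ) ^ n ≤ {a : Fin n → ZMod N | NoShortRelation R a}.ncard := by
  have hNpos : (0 : ℝ) < N := by exact_mod_cast NeZero.pos N
  have h1 : (N : ℝ) * {a : Fin n → ZMod N | ¬ NoShortRelation R a}.ncard ≤
      (2 * R + 1) ^ n * (R * N ^ n) := by
    exact_mod_cast mul_ncard_not_noShortRelation_le (N := N) (n := n) R
  rw [div_le_iff₀ hε] at hN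
  have h2 : ({a : Fin n → ZMod N | ¬ NoShortRelation R a}.ncard : ℝ) ≤ ε * N ^ n := by
    refine le_of_mul_le_mul_left (h1.trans ?_) hNpos
    nlinarith [mul_le_mul_of_nonneg_right hN (pow_nonneg hNpos.le n)]
  have h3 := Set.ncard_add_ncard_compl {a : Fin n → ZMod N | NoShortRelation R a}
  rw [Nat.card_eq_fintype_card, Fintype.card_fun, ZMod.card, Fintype.card_fin,
    Set.compl_ofPred] at h3
  have h4 : ({a : Fin n → ZMod N | NoShortRelation R a}.ncard : ℝ) +
      {a : Fin n → ZMod N | ¬ NoShortRelation R a}.ncard = (N : ℝ) ^ n := by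
    exact_mod_cast h3
  linarith

end Counting

/-! ### Families in `Omega`, orthogonal systems and duality. -/

section Family

variable {n m N : ℕ} {B : Fin n → Fin m → ℤ}

theorem F_zsmul (k : ℤ) (a : Fin n → ZMod N) : F N B (k • a) = k • F N B a := by
  simp only [F, Finset.smul_sum, Pi.smul_apply, smul_assoc]

theorem redMod_linearCombination (c : Fin n → ℤ) :
    redMod N m (Fintype.linearCombination ℤ B c) = F N B (redMod N n c) := by
  simp only [Fintype.linearCombination_apply, map_sum, map_smul, F]
  refine Finset.sum_congr rfl fun i _ => ?_
  ext j
  simp [redMod]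

theorem F_injective (hB : LinearIndependent (ZMod N) fun i => redMod N m (B i)) :
    Function.Injective (F N B) := by
  intro a b hab
  have h := Fintype.linearIndependent_iff.1 hB (a - b) (by
    simpa [F, sub_smul, Finset.sum_sub_distrib, sub_eq_zero] using hab)
  ext1 i
  exact sub_eq_zero.1 (h i)

/-- A family that is independent modulo `N ≥ 2` is independent over `ℤ`. -/
theorem linearIndependent_of_redMod (hN : 2 ≤ N)
    (hB : LinearIndependent (ZMod N) fun i => redMod N m (B i)) : LinearIndependent ℤ B := by
  rw [Fintype.linearIndependent_iff]
  intro c hc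
  by_contra! hne
  obtain ⟨i₀, hi₀⟩ := hne
  -- Dividing by the gcd makes the relation primitive; independence modulo `N` would then force `N`
  -- to divide `1`.
  obtain ⟨g, hg, hg1⟩ := Finset.extract_gcd c ⟨i₀, Finset.mem_univ i₀⟩
  have hd : Finset.univ.gcd c ≠ 0 := fun h0 => hi₀ (by rw [hg i₀ (Finset.mem_univ _), h0, zero_mul])
  have hgB : ∑ i, g i • B i = 0 := by
    apply smul_right_injective _ hd
    simp only [smul_zero, Finset.smul_sum, smul_smul]
    rw [← hc]
    exact Finset.sum_congr rfl fun i hi => by rw [← hg i hi]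
  have hF : F N B (redMod N n g) = 0 := by
    rw [← redMod_linearCombination, Fintype.linearCombination_apply, hgB, map_zero]
  have h0 : redMod N n g = 0 := by
    apply F_injective hB
    rw [hF]
    simp [F]
  have hdvd : (N : ℤ) ∣ Finset.univ.gcd g := Finset.dvd_gcd fun i _ =>
    (ZMod.intCast_zmod_eq_zero_iff_dvd _ _).1 (congrFun h0 i)
  rw [hg1] at hdvd
  have := Int.le_of_dvd one_pos hdvd
  omega

theorem le_ncard_of_noShortRelation [NeZero N]
    (hB : LinearIndependent (ZMod N) fun i => redMod N m (B i)) {R : ℕ} {ε : ℝ} (hε : 0 < ε)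
    (hN : ((2 * R + 1) ^ n * R : ℝ) / ε ≤ N) {S : Set (Fin m → ZMod N)}
    (hS : ∀ a, NoShortRelation R a → F N B a ∈ S) :
    (1 - ε) * ((H N B).ncard : ℝ) ≤ S.ncard := by
  have hinj := F_injective hB
  have hH : (H N B).ncard = N ^ n := by
    rw [H, ← Set.image_univ, Set.ncard_image_of_injective _ hinj, Set.ncard_univ]
    simp [Nat.card_eq_fintype_card, ZMod.card]
  have h1 : {a : Fin n → ZMod N | NoShortRelation R a}.ncard ≤ S.ncard := by
    rw [← Set.ncard_image_of_injective _ hinj]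
    refine Set.ncard_le_ncard ?_ (Set.toFinite _)
    rintro _ ⟨a, ha, rfl⟩
    exact hS a ha
  rw [hH, Nat.cast_pow]
  exact (le_ncard_noShortRelation hε hN).trans (by exact_mod_cast h1)

theorem norm_toE_le_of_size_le {μ : ℝ} (hn : 0 < n) (hμ : size B ≤ μ) (i : Fin n) :
    ‖toE (B i)‖ ≤ n * μ := by
  have hone : (1 : ℝ) ≤ n := by exact_mod_cast hn
  have hμ0 : 0 ≤ μ := (Real.sqrt_nonneg _).trans hμ
  have h1 : (1 / (n : ℝ)) * ∑ i, ‖toE (B i)‖ ^ 2 ≤ μ ^ 2 := (Real.sqrt_le_left hμ0).1 hμ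
  have h2 : ‖toE (B i)‖ ^ 2 ≤ ∑ i, ‖toE (B i)‖ ^ 2 :=
    Finset.single_le_sum (f := fun i => ‖toE (B i)‖ ^ 2) (fun _ _ => by positivity)
      (Finset.mem_univ i)
  rw [one_div, ← div_eq_inv_mul, div_le_iff₀ (by linarith)] at h1
  refine abs_le_of_sq_le_sq' ?_ (by positivity) |>.2
  nlinarith [mul_nonneg (sq_nonneg μ) (sub_nonneg.2 hone)]

/-- Bounded families of `n` vectors have uniformly bounded systems of `m - n` independent
orthogonal vectors. -/
theorem exists_bounded_orthogonal (n m : ℕ) (E : ℝ) :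
    ∃ K : ℝ, 0 < K ∧ ∀ B : Fin n → Fin m → ℤ, (∀ i, ‖toE (B i)‖ ≤ E) →
      ∃ w : Fin (m - n) → Fin m → ℤ, LinearIndependent ℤ w ∧ (∀ i j, B i ⬝ᵥ w j = 0) ∧
        ∀ j, ‖toE (w j)‖ ≤ K := by
  -- Uniformity comes from finiteness: only finitely many integer families satisfy the bound.
  have hfin : {B : Fin n → Fin m → ℤ | ∀ i, ‖toE (B i)‖ ≤ E}.Finite := by
    refine (Set.finite_Icc (fun _ _ => -⌈E⌉) (fun _ _ => ⌈E⌉)).subset fun B hB => ?_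
    have h : ∀ i j, |B i j| ≤ ⌈E⌉ := fun i j => by
      have := ((abs_le_norm_toE (B i) j).trans (hB i)).trans (Int.le_ceil E)
      exact_mod_cast this
    exact ⟨fun i j => (abs_le.1 (h i j)).1, fun i j => (abs_le.1 (h i j)).2⟩
  choose w hw hBw using fun B : Fin n → Fin m → ℤ => exists_linearIndependent_orthogonal B
  obtain ⟨K, hK⟩ := (hfin.image fun B => ∑ j, ‖toE (w B j)‖).bddAbove
  refine ⟨max K 1, by positivity, fun B hB => ⟨w B, hw B, hBw B, fun j => ?_⟩⟩
  refine le_trans ?_ ((hK ⟨B, hB, rfl⟩).trans (le_max_left _ _))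
  exact Finset.single_le_sum (f := fun j => ‖toE (w B j)‖) (fun _ _ => norm_nonneg _)
    (Finset.mem_univ j)

theorem abs_dotProduct_le (v w : Fin m → ℤ) : |((v ⬝ᵥ w : ℤ) : ℝ)| ≤ ‖toE v‖ * ‖toE w‖ := by
  rw [← inner_toE]
  exact abs_real_inner_le_norm _ _

theorem intCast_dotProduct (v w : Fin m → ℤ) :
    ((v ⬝ᵥ w : ℤ) : ZMod N) = redMod N m v ⬝ᵥ redMod N m w := by
  simp [dotProduct, redMod]

theorem redMod_surjective (N n : ℕ) : Function.Surjective (redMod N n) := fun a =>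
  ⟨fun j => (ZMod.intCast_surjective (a j)).choose, by
    ext j
    exact (ZMod.intCast_surjective (a j)).choose_spec⟩

theorem dotProduct_F (v : Fin m → ℤ) (a : Fin n → ZMod N) :
    redMod N m v ⬝ᵥ F N B a = ∑ i, ((v ⬝ᵥ B i : ℤ) : ZMod N) * a i := by
  simp only [F, dotProduct_sum, dotProduct_smul, intCast_dotProduct, smul_eq_mul, mul_comm]

/-- One integer lift of `h` suffices as a test vector. -/
theorem mem_orthModLattice_iff {h : Fin m → ZMod N} {v : Fin m → ℤ} :
    v ∈ orthModLattice (Submodule.span ℤ {h}) ↔ redMod N m v ⬝ᵥ h = 0 := by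
  constructor
  · intro hv
    obtain ⟨w, rfl⟩ := redMod_surjective N m h
    rw [← intCast_dotProduct, ZMod.intCast_zmod_eq_zero_iff_dvd]
    exact hv w (Submodule.mem_span_singleton_self _)
  · intro hv w hw
    obtain ⟨k, hk⟩ := Submodule.mem_span_singleton.1 (show redMod N m w ∈ _ from hw)
    rw [← ZMod.intCast_zmod_eq_zero_iff_dvd, intCast_dotProduct, ← hk, dotProduct_smul, hv,
      smul_zero]

theorem redMod_smul_self (v : Fin m → ℤ) : redMod N m ((N : ℤ) • v) = 0 := by
  ext j
  simp [redMod]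

/-- A reduced basis of the congruence lattice of `a` is short if `a` satisfies no short relation:
its last Gram–Schmidt vector, rescaled, is a relation. -/
theorem mul_norm_gs_last_le [NeZero N] {a : Fin n → ZMod N} {R : ℕ} (ha : NoShortRelation R a)
    {b : Fin n → Fin n → ℤ} (hb : IsLatticeBasis b (congLattice (Submodule.span ℤ {a})))
    {l : Fin n} (hl : ∀ j, j ≤ l) : R * ‖gs b l‖ ≤ N := by
  by_contra! hlt
  have hNpos : (0 : ℝ) < N := by exact_mod_cast NeZero.pos N
  have hg0 : 0 < ‖gs b l‖ := by
    by_contra! h0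
    nlinarith [norm_nonneg (gs b l), (Nat.cast_nonneg R : (0 : ℝ) ≤ R)]
  -- With `g = gs b l`, the vector `g / ‖g‖²` lies in the dual lattice, since `l` is the last index.
  have hint : ∀ x ∈ congLattice (Submodule.span ℤ {a}),
      ∃ z : ℤ, inner ℝ (toE x) (gs b l) = z * ‖gs b l‖ ^ 2 := by
    intro x hx
    rw [← hb.2, Submodule.mem_span_range_iff_exists_fun] at hx
    obtain ⟨c, rfl⟩ := hx
    refine ⟨c l, ?_⟩
    rw [toE_sum, sum_inner, Finset.sum_eq_single l]
    · rw [toE_smul, real_inner_smul_left, inner_toE_gs_self]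
    · intro p _ hp
      rw [toE_smul, real_inner_smul_left, inner_toE_gs_of_lt b (lt_of_le_of_ne (hl p) hp),
        mul_zero]
    · simp
  have hsingle : ∀ j : Fin n, inner ℝ (toE ((N : ℤ) • Pi.single j (1 : ℤ))) (gs b l) =
      N * gs b l j := by
    intro j
    rw [toE_smul, real_inner_smul_left]
    have : toE (Pi.single j (1 : ℤ) : Fin n → ℤ) = EuclideanSpace.single j (1 : ℝ) := by
      ext p
      by_cases hp : p = j
      · subst hp; simp [toE]
      · simp [toE, hp]
    rw [this, EuclideanSpace.inner_single_left]
    simp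
  -- Here `c = N g / ‖g‖²`, integral because each `N eⱼ` is in the lattice. Pairing it with a lift
  -- of `a` gives a multiple of `N`, and `|c j| ≤ N / ‖g‖ < R`, so `c` is a forbidden relation
  -- unless it is `0`.
  choose c hc using fun j : Fin n => hint ((N : ℤ) • Pi.single j (1 : ℤ)) (by
    rw [congLattice, Submodule.mem_comap, redMod_smul_self]
    exact Submodule.zero_mem _)
  simp only [hsingle] at hc
  obtain ⟨a', ha'⟩ := redMod_surjective N n a
  obtain ⟨z, hz⟩ := hint a' (by
    rw [congLattice, Submodule.mem_comap, ha']
    exact Submodule.mem_span_singleton_self _)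
  have hsum : c ⬝ᵥ a' = N * z := by
    have h1 : ((c ⬝ᵥ a' : ℤ) : ℝ) * ‖gs b l‖ ^ 2 = (N * z : ℤ) * ‖gs b l‖ ^ 2 := by
      push_cast
      rw [mul_assoc, ← hz, dotProduct]
      push_cast
      rw [Finset.sum_mul, PiLp.inner_apply, Finset.mul_sum]
      refine Finset.sum_congr rfl fun j _ => ?_
      have := hc j
      simp only [toE, RCLike.inner_apply, conj_trivial]
      linear_combination -(a' j : ℝ) * this
    exact_mod_cast mul_right_cancel₀ (by positivity) h1
  have hcz : c = 0 := by
    refine ha c (fun j => ?_) ?_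
    · have h1 : |(c j : ℝ)| * ‖gs b l‖ ^ 2 ≤ N * ‖gs b l‖ := by
        have h2 : |(c j : ℝ)| * ‖gs b l‖ ^ 2 = N * |gs b l j| := by
          rw [← abs_of_nonneg (sq_nonneg ‖gs b l‖), ← abs_mul, ← hc j, abs_mul, Nat.abs_cast]
        rw [h2]
        exact mul_le_mul_of_nonneg_left (PiLp.norm_apply_le (gs b l) j) hNpos.le
      have h3 : |(c j : ℝ)| ≤ R := by
        by_contra! h4
        nlinarith [mul_lt_mul_of_pos_right h4 (pow_pos hg0 2), mul_lt_mul_of_pos_right hlt hg0]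
      exact_mod_cast h3
    · have h1 : ((c ⬝ᵥ a' : ℤ) : ZMod N) = 0 := by rw [hsum]; simp
      rw [← ha']
      simpa [dotProduct, redMod] using h1
  refine hg0.ne' (norm_eq_zero.2 ?_)
  ext j
  have := hc j
  rw [hcz] at this
  simpa [hNpos.ne'] using this

end Family

/-! ### Success of both algorithms in the absence of short relations. -/

section Algorithms

variable {n m N : ℕ} [NeZero N] {δ : ℝ} {B : Fin n → Fin m → ℤ}
  {w : Fin (m - n) → Fin m → ℤ} {a : Fin n → ZMod N} {R : ℕ}

theorem computes_algorithmI (hnm : n < m) (hδ : 1 / 4 < δ) (hδ' : δ < 1)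
    (hB : LinearIndependent ℤ B) (hw : LinearIndependent ℤ w) (hBw : ∀ i j, B i ⬝ᵥ w j = 0)
    {E K : ℝ} (hE : ∀ i, ‖toE (B i)‖ ≤ E) (hK : ∀ j, ‖toE (w j)‖ ≤ K) (hK0 : 0 ≤ K)
    (hR : lllFactor m δ * K * E ≤ R) (ha : NoShortRelation R a) :
    Computes (AlgorithmI δ n (Submodule.span ℤ {F N B a})) (completion (hidden B)) := by
  have hwM : ∀ j, w j ∈ orthModLattice (Submodule.span ℤ {F N B a}) := fun j => by
    rw [mem_orthModLattice_iff, dotProduct_F]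
    refine Finset.sum_eq_zero fun i _ => ?_
    rw [dotProduct_comm, hBw, Int.cast_zero, zero_mul]
  have key : ∀ u, IsOrderedLLLOutput δ (orthModLattice (Submodule.span ℤ {F N B a})) u →
      completion (hidden B) = orth (firstSpan (m - n) u) := by
    intro u hu
    rw [firstSpan_eq (Nat.sub_le m n)]
    refine completion_eq_orth hB (hu.isLatticeBasis.1.comp _ (Fin.castLE_injective _))
      (fun i j => ?_) (by omega)
    set v := (u ∘ Fin.castLE (Nat.sub_le m n)) j with hv
    have hnorm : ‖toE v‖ ≤ lllFactor m δ * K :=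
      hu.norm_le_of_linearIndependent hδ hδ' hw hwM hK j.2
    have hmem : v ∈ orthModLattice (Submodule.span ℤ {F N B a}) :=
      hu.isLatticeBasis.2.le (Submodule.subset_span ⟨_, rfl⟩)
    rw [mem_orthModLattice_iff, dotProduct_F] at hmem
    -- The products `⟨v, Bᵢ⟩` are the coefficients of a short relation on `a`.
    have h0 := ha (fun i => v ⬝ᵥ B i) (fun i => ?_) hmem
    · rw [dotProduct_comm]
      exact congrFun h0 i
    · have h1 : |((v ⬝ᵥ B i : ℤ) : ℝ)| ≤ R :=
        (abs_dotProduct_le _ _).trans ((mul_le_mul hnorm (hE i) (norm_nonneg _)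
          (mul_nonneg (lllFactor_nonneg _ _) hK0)).trans hR)
      exact_mod_cast h1
  constructor
  · obtain ⟨b₀, hb₀⟩ := exists_isLatticeBasis_of_smul_mem
      (L := orthModLattice (Submodule.span ℤ {F N B a})) (N := N)
      (by exact_mod_cast NeZero.ne N) fun v => by
        rw [mem_orthModLattice_iff, redMod_smul_self, zero_dotProduct]
    obtain ⟨u, hu⟩ := exists_isOrderedLLLOutput hδ'.le hb₀
    obtain ⟨x, hx⟩ := exists_isLatticeBasis_completion hB hw hBw (by omega)
    exact ⟨x, u, hu, by rw [← key u hu]; exact hx⟩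
  · rintro x ⟨u, hu, hx⟩
    rw [key u hu]
    exact hx

/-- Without short relations, the congruence lattice of `F N B a` contains `n` independent vectors
that are short compared with `N`. -/
theorem exists_short_mem_congLattice (hn : 0 < n) (hδ : 1 / 4 < δ) (hδ' : δ < 1)
    (hB : LinearIndependent ℤ B) {E : ℝ} (hE : ∀ i, ‖toE (B i)‖ ≤ E) (hR0 : 0 < R)
    (ha : NoShortRelation R a) :
    ∃ x : Fin n → Fin m → ℤ, LinearIndependent ℤ x ∧
      (∀ i, x i ∈ congLattice (Submodule.span ℤ {F N B a})) ∧
      ∀ i, ‖toE (x i)‖ ≤ n * (lllFactor n δ * (N / R) * E) := by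
  obtain ⟨b₀, hb₀⟩ := exists_isLatticeBasis_of_smul_mem
    (L := congLattice (Submodule.span ℤ {a})) (N := N) (by exact_mod_cast NeZero.ne N) fun v => by
      rw [congLattice, Submodule.mem_comap, redMod_smul_self]
      exact Submodule.zero_mem _
  obtain ⟨b, hb⟩ := exists_isLLLReducedBasis hδ'.le hb₀
  let l : Fin n := ⟨n - 1, by omega⟩
  have hl : ∀ j, j ≤ l := fun j => by rw [Fin.le_def]; exact Nat.le_sub_one_of_lt j.2
  have hgs : ‖gs b l‖ ≤ N / R := by
    rw [le_div_iff₀ (by exact_mod_cast hR0), mul_comm]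
    exact mul_norm_gs_last_le ha hb.basis hl
  have hbn : ∀ i, ‖toE (b i)‖ ≤ lllFactor n δ * (N / R) := fun i =>
    (hb.norm_le hδ hδ' (hl i)).trans (mul_le_mul_of_nonneg_left hgs (lllFactor_nonneg _ _))
  -- Pushing `b` forward along `c ↦ ∑ cᵢ Bᵢ` sends lifts of multiples of `a` to lifts of multiples
  -- of `F N B a`.
  refine ⟨fun i => Fintype.linearCombination ℤ B (b i), hb.basis.1.map' _ ?_, fun i => ?_,
    fun i => ?_⟩
  · rw [LinearMap.ker_eq_bot]
    exact linearIndependent_iff_injective_fintypeLinearCombination.1 hB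
  · have hi : b i ∈ congLattice (Submodule.span ℤ {a}) :=
      hb.basis.2.le (Submodule.subset_span ⟨i, rfl⟩)
    rw [congLattice, Submodule.mem_comap, Submodule.mem_span_singleton] at hi
    obtain ⟨k, hk⟩ := hi
    rw [congLattice, Submodule.mem_comap, redMod_linearCombination, ← hk, F_zsmul]
    exact Submodule.smul_mem _ _ (Submodule.mem_span_singleton_self _)
  · beta_reduce
    rw [Fintype.linearCombination_apply, toE_sum]
    refine (norm_sum_le_of_le _ fun j _ => ?_).trans_eq
      (by rw [Finset.sum_const, Finset.card_univ, Fintype.card_fin, nsmul_eq_mul])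
    rw [toE_smul, norm_smul, Real.norm_eq_abs]
    exact mul_le_mul ((abs_le_norm_toE _ _).trans (hbn i)) (hE j) (norm_nonneg _)
      ((norm_nonneg _).trans (hbn i))

theorem computes_algorithmII (hn : 0 < n) (hnm : n < m) (hδ : 1 / 4 < δ) (hδ' : δ < 1)
    (hB : LinearIndependent ℤ B) (hw : LinearIndependent ℤ w) (hBw : ∀ i j, B i ⬝ᵥ w j = 0)
    {E K : ℝ} (hE : ∀ i, ‖toE (B i)‖ ≤ E) (hK : ∀ j, ‖toE (w j)‖ ≤ K) (hR0 : 0 < R)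
    (hR : lllFactor m δ * (n * (lllFactor n δ * E)) * K < R) (ha : NoShortRelation R a) :
    Computes (AlgorithmII δ n (Submodule.span ℤ {F N B a})) (completion (hidden B)) := by
  have hNpos : (0 : ℝ) < N := by exact_mod_cast NeZero.pos N
  have hRpos : (0 : ℝ) < R := by exact_mod_cast hR0
  obtain ⟨x, hx, hxM, hxn⟩ := exists_short_mem_congLattice hn hδ hδ' hB hE hR0 ha
  have key : ∀ u, IsOrderedLLLOutput δ (congLattice (Submodule.span ℤ {F N B a})) u →
      completion (firstSpan n u) = completion (hidden B) := by
    intro u hu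
    rw [firstSpan_eq hnm.le, completion_eq_orth
      (hu.isLatticeBasis.1.comp _ (Fin.castLE_injective hnm.le)) hw (fun i j => ?_) (by omega)]
    · exact (completion_eq_orth hB hw hBw (by omega)).symm
    set v := (u ∘ Fin.castLE hnm.le) i with hv
    have hnorm : ‖toE v‖ ≤ lllFactor m δ * (n * (lllFactor n δ * (N / R) * E)) :=
      hu.norm_le_of_linearIndependent hδ hδ' hx hxM hxn i.2
    have hmem : v ∈ congLattice (Submodule.span ℤ {F N B a}) :=
      hu.isLatticeBasis.2.le (Submodule.subset_span ⟨_, rfl⟩)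
    rw [congLattice, Submodule.mem_comap, Submodule.mem_span_singleton] at hmem
    obtain ⟨k, hk⟩ := hmem
    have hdvd : (N : ℤ) ∣ v ⬝ᵥ w j := by
      rw [← ZMod.intCast_zmod_eq_zero_iff_dvd, intCast_dotProduct, ← hk, smul_dotProduct,
        dotProduct_comm, dotProduct_F, Finset.sum_eq_zero fun i _ => ?_, smul_zero]
      rw [dotProduct_comm, hBw, Int.cast_zero, zero_mul]
    -- The norm of `v` is proportional to `N / R`, so a large enough `R` brings the product below
    -- `N`.
    refine Int.eq_zero_of_abs_lt_dvd hdvd ?_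
    have h1 : |((v ⬝ᵥ w j : ℤ) : ℝ)| < N := by
      calc |((v ⬝ᵥ w j : ℤ) : ℝ)| ≤ ‖toE v‖ * ‖toE (w j)‖ := abs_dotProduct_le _ _
        _ ≤ lllFactor m δ * (n * (lllFactor n δ * (N / R) * E)) * K :=
            mul_le_mul hnorm (hK j) (norm_nonneg _) ((norm_nonneg _).trans hnorm)
        _ = lllFactor m δ * (n * (lllFactor n δ * E)) * K * (N / R) := by ring
        _ < R * (N / R) := mul_lt_mul_of_pos_right hR (by positivity)
        _ = N := by field_simp
    exact_mod_cast h1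
  constructor
  · obtain ⟨b₀, hb₀⟩ := exists_isLatticeBasis_of_smul_mem
      (L := congLattice (Submodule.span ℤ {F N B a})) (N := N)
      (by exact_mod_cast NeZero.ne N) fun v => by
        rw [congLattice, Submodule.mem_comap, redMod_smul_self]
        exact Submodule.zero_mem _
    obtain ⟨u, hu⟩ := exists_isOrderedLLLOutput hδ'.le hb₀
    obtain ⟨y, hy⟩ := exists_isLatticeBasis_completion hB hw hBw (by omega)
    exact ⟨y, u, hu, by rw [key u hu]; exact hy⟩
  · rintro y ⟨u, hu, hy⟩
    rwa [key u hu] at hy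

end Algorithms

/-! ### The explicit thresholds and the conclusion. -/

theorem exists_bound_algorithmI {n m : ℕ} (hn : 0 < n) (hnm : n < m) {μ δ ε : ℝ}
    (hδ : 1 / 4 < δ) (hδ' : δ < 1) (hε : 0 < ε) :
    ∃ N₀ : ℝ, 0 < N₀ ∧ ∀ N : ℕ, N₀ < (N : ℝ) → ∀ B ∈ Omega n m μ N,
      (1 - ε) * ((H N B).ncard : ℝ) ≤ ((HI δ N B).ncard : ℝ) := by
  obtain ⟨K, hK0, hK⟩ := exists_bounded_orthogonal n m (n * μ)
  let R : ℕ := ⌈lllFactor m δ * K * (n * μ)⌉₊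
  have hpos : 0 ≤ ((2 * R + 1) ^ n * R : ℝ) / ε := by positivity
  -- The first term makes the bad proportion at most `ε`; the summand `2` ensures `N ≥ 2`, needed
  -- for independence over `ℤ`.
  refine ⟨((2 * R + 1) ^ n * R : ℝ) / ε + 2, by positivity, fun N hN B hB => ?_⟩
  have hN2 : 2 ≤ N := by
    have : (2 : ℝ) < N := (le_add_of_nonneg_left hpos).trans_lt hN
    exact_mod_cast this.le
  have : NeZero N := ⟨by omega⟩
  have hE := norm_toE_le_of_size_le hn hB.2
  obtain ⟨w, hw, hBw, hwK⟩ := hK B hE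
  exact le_ncard_of_noShortRelation hB.1 hε
    ((le_add_of_nonneg_right zero_le_two).trans hN.le) fun a ha =>
    ⟨⟨a, rfl⟩, computes_algorithmI hnm hδ hδ' (linearIndependent_of_redMod hN2 hB.1) hw hBw hE
      hwK hK0.le (Nat.le_ceil _) ha⟩

theorem exists_bound_algorithmII {n m : ℕ} (hn : 0 < n) (hnm : n < m) {μ δ ε : ℝ}
    (hδ : 1 / 4 < δ) (hδ' : δ < 1) (hε : 0 < ε) :
    ∃ N₀ : ℝ, 0 < N₀ ∧ ∀ N : ℕ, N₀ < (N : ℝ) → ∀ B ∈ Omega n m μ N,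
      (1 - ε) * ((H N B).ncard : ℝ) ≤ ((HII δ N B).ncard : ℝ) := by
  obtain ⟨K, hK0, hK⟩ := exists_bounded_orthogonal n m (n * μ)
  -- Floor plus one, rather than a ceiling, gives both `0 < R` and the strict inequality.
  let R : ℕ := ⌊lllFactor m δ * (n * (lllFactor n δ * (n * μ))) * K⌋₊ + 1
  have hpos : 0 ≤ ((2 * R + 1) ^ n * R : ℝ) / ε := by positivity
  refine ⟨((2 * R + 1) ^ n * R : ℝ) / ε + 2, by positivity, fun N hN B hB => ?_⟩
  have hN2 : 2 ≤ N := by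
    have : (2 : ℝ) < N := (le_add_of_nonneg_left hpos).trans_lt hN
    exact_mod_cast this.le
  have : NeZero N := ⟨by omega⟩
  have hE := norm_toE_le_of_size_le hn hB.2
  obtain ⟨w, hw, hBw, hwK⟩ := hK B hE
  exact le_ncard_of_noShortRelation hB.1 hε
    ((le_add_of_nonneg_right zero_le_two).trans hN.le) fun a ha =>
    ⟨⟨a, rfl⟩, computes_algorithmII hn hnm hδ hδ' (linearIndependent_of_redMod hN2 hB.1) hw hBw hE
      hwK (Nat.succ_pos _) (by exact_mod_cast Nat.lt_floor_add_one _) ha⟩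

end HLP

end

theorem corollary1 (n m : ℕ) (hn : 3 ≤ n) (hnm : n < m) (μ δ ε : ℝ) (hμ : 1 ≤ μ)
    (hδ : 1 / 4 < δ) (hδ' : δ < 1) (hε : 0 < ε) (hε' : ε < 1) :
    ∃ NI NII : ℝ, 0 < NI ∧ 0 < NII ∧
      (∀ N : ℕ, NI < (N : ℝ) → ∀ B ∈ HLP.Omega n m μ N,
        (1 - ε) * ((HLP.H N B).ncard : ℝ) ≤ ((HLP.HI δ N B).ncard : ℝ)) ∧
      (∀ N : ℕ, NII < (N : ℝ) → ∀ B ∈ HLP.Omega n m μ N,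
        (1 - ε) * ((HLP.H N B).ncard : ℝ) ≤ ((HLP.HII δ N B).ncard : ℝ)) ∧
      (∀ N : ℕ, min NI NII < (N : ℝ) → ∀ B ∈ HLP.Omega n m μ N,
        (min NI NII = NI →
          (1 - ε) * ((HLP.H N B).ncard : ℝ) ≤ ((HLP.HI δ N B).ncard : ℝ)) ∧
        (min NI NII ≠ NI →
          (1 - ε) * ((HLP.H N B).ncard : ℝ) ≤ ((HLP.HII δ N B).ncard : ℝ))) := by
  obtain ⟨NI, hNI, hI⟩ := HLP.exists_bound_algorithmI (μ := μ) (by omega) hnm hδ hδ' hε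
  obtain ⟨NII, hNII, hII⟩ := HLP.exists_bound_algorithmII (μ := μ) (by omega) hnm hδ hδ' hε
  refine ⟨NI, NII, hNI, hNII, hI, hII, fun N hN B hB => ⟨fun h => ?_, fun h => ?_⟩⟩
  · exact hI N (h ▸ hN) B hB
  · exact hII N ((min_choice NI NII).resolve_left h ▸ hN) B hB
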